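/- Let $\mathcal I$ be a generalised inverse category, i.e. a category with a function $\deg:\mathrm{ob}\,\mathcal I\to\mathbb N$ such that $\deg i>\deg j$ for every non-isomorphism $i\to j$ and $\deg i=\deg j$ whenever $i\cong j$. Let $\mathbb G_n(\mathcal I)$ be the groupoid of objects of degree $n$ and isomorphisms between them, and let $\mathcal I^-(i)$ be the full subcategory of the under category $i/\mathcal I$ on the maps $i\to j$ with $\deg j<\deg i$. Let $\mathcal E$ be a category with pullbacks and with limits of shape $\mathcal I^-(i)$ for every $i\in\mathcal I$. For $X\in\mathcal E^{\mathcal I}$ write $M_iX=\lim(\mathcal I^-(i)\to\mathcal I\xrightarrow{X}\mathcal E)$ for the matching object and $m_iX:X_i\to M_iX$ for the matching map. Call a map *powerful* if pullback along it exists and has a right adjoint. For a powerful map $h:b\to a$ write $\Pi_b$ for the right adjoint of $h^*$, write $\mathrm{ev}$ for the counit, and write $u^\ddagger:d\to\Pi_b c$ for the transpose of a map $u:b\times_a d\to c$ over $b$. Let $f:B\to A$ be a map in $\mathcal E^{\mathcal I}$ such that 1. each component $f_i:B_i\to A_i$ is powerful in $\mathcal E$; 2. each map $M_if:M_iB\to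 M_iA$ is powerful in $\mathcal E$; 3. for every $n$, either the groupoid $\mathbb G_n(\mathcal I)$ is connected (possibly empty), or $\mathcal E$ has an initial object. Then $f$ is powerful in $\mathcal E^{\mathcal I}$, i.e. pullback along $f$ has a right adjoint $\Pi_B$. Moreover, for every $g:C\to B$ in $\mathcal E^{\mathcal I}$ and every $i\in\mathcal I$, the following square is a pullback in $\mathcal E$: $$\begin{array}{ccc} (\Pi_BC)_i & \xrightarrow{\ \mathrm{ev}_i^{\ddagger}\ } & \Pi_{B_i}C_i\\ \downarrow & & \downarrow\\ A_i\times_{M_iA}M_i(\Pi_BC) & \longrightarrow & \Pi_{B_i}(B_i\times_{M_iB}M_iC) \end{array}$$ Here the left map has as components the projection $(\Pi_BC)_i\to A_i$ and the matching map $m_i(\Pi_BC)$; the right map is $\Pi_{B_i}(g_i,m_iC)$; the top map is the transpose along $f_i$ of the component at $i$ of $\mathrm{ev}:B\times_A\Pi_BC\to C$; and the bottom map is the composite $$A_i\times_{M_iA}M_i(\Pi_BC)\xrightarrow{A_i\times_{M_iA}M_i(\mathrm{ev})^{\ddagger}}A_i\times_{M_iA}\Pi_{M_iB}M_iC\xrightarrow{(B_i\times_{M_iB}\mathrm{ev})^{\ddagger}}\Pi_{B_i}(B_i\times_{M_iB}M_iC),$$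 where $M_i(\mathrm{ev})^{\ddagger}$ is the transpose along $M_if$ of $M_iB\times_{M_iA}M_i(\Pi_BC)\cong M_i(B\times_A\Pi_BC)\xrightarrow{M_i(\mathrm{ev})}M_iC$, and the second map is the transpose along $f_i$ of $B_i\times_{A_i}(A_i\times_{M_iA}\Pi_{M_iB}M_iC)\cong B_i\times_{M_iB}(M_iB\times_{M_iA}\Pi_{M_iB}M_iC)\xrightarrow{B_i\times_{M_iB}\mathrm{ev}}B_i\times_{M_iB}M_iC$. -/

import Mathlib

open CategoryTheory CategoryTheory.Limits

universe v₁ v₂ u₁ u₂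

noncomputable section

/-! ## Powerful maps and dependent products -/

/-- A map is *powerful* if pullback along it exists and has a right adjoint. -/
def IsPowerful {C : Type u₁} [Category.{v₁} C] {b a : C} (f : b ⟶ a) : Prop :=
  ∃ _ : HasPullbacksAlong f, (Over.pullback f).IsLeftAdjoint

section DependentProduct

variable {C : Type u₁} [Category.{v₁} C] [HasPullbacks C] {b a : C} {f : b ⟶ a}

/-- The dependent product functor `Π_f : C/b ⥤ C/a`, right adjoint to pullback along `f`. -/
def depProd (hf : IsPowerful f) : Over b ⥤ Over a :=
  haveI : (Over.pullback f).IsLeftAdjoint := hf.2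
  (Over.pullback f).rightAdjoint

/-- The adjunction `f^* ⊣ Π_f`. -/
def depProdAdj (hf : IsPowerful f) : Over.pullback f ⊣ depProd hf :=
  haveI : (Over.pullback f).IsLeftAdjoint := hf.2
  Adjunction.ofIsLeftAdjoint (Over.pullback f)

/-- The evaluation (counit) `ev : b ×_a Π_f w ⟶ w` over `b`. -/
def depProdEv (hf : IsPowerful f) (w : Over b) :
    (Over.pullback f).obj ((depProd hf).obj w) ⟶ w :=
  (depProdAdj hf).counit.app w

/-- The transpose `u^‡ : d ⟶ Π_f w` over `a` of a map `u : b ×_a d ⟶ w` over `b`. -/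
def depProdTranspose (hf : IsPowerful f) {d : Over a} {w : Over b}
    (u : (Over.pullback f).obj d ⟶ w) : d ⟶ (depProd hf).obj w :=
  (depProdAdj hf).homEquiv d w u

end DependentProduct

section Comparison

variable {D : Type u₁} [Category.{v₁} D] [HasPullbacks D]
  {E : Type u₂} [Category.{v₂} E] [HasPullbacks E]

/-- For a pullback-preserving functor `F` and powerful maps `k : y ⟶ x` and `F k`, the canonical
comparison map `F(ev)^‡ : F (Π_k z) ⟶ Π_{F k} (F z)` over `F x`. It is the transpose of
`F (Π_k z) ×_{F x} F y ≅ F (Π_k z ×_x y) ⟶ F z`, where the last map is `F(ev)`. -/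
def depProdComparison (F : D ⥤ E) [PreservesLimitsOfShape WalkingCospan F] {y x : D} {k : y ⟶ x}
    (hk : IsPowerful k) (hFk : IsPowerful (F.map k)) (z : Over y) :
    Over.mk (F.map ((depProd hk).obj z).hom) ⟶ (depProd hFk).obj (Over.mk (F.map z.hom)) :=
  depProdTranspose hFk
    (Over.homMk
      ((PreservesPullback.iso F ((depProd hk).obj z).hom k).inv ≫ F.map (depProdEv hk z).left)
      (by
        have h := Over.w (depProdEv hk z)
        simp only [Over.pullback_obj_hom] at h
        simp [← F.map_comp, h]))

/-- For a commutative square `g ≫ α = β ≫ k` with `g : b ⟶ a` and `k : y ⟶ x` powerful and `w` over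
`y`, the map `(b ×_y ev)^‡ : a ×_x Π_k w ⟶ Π_g (b ×_y w)` over `a`. It is the transpose of
`b ×_a (a ×_x Π_k w) = b ×_y (y ×_x Π_k w) ⟶ b ×_y w`, the last map being `b ×_y ev`. -/
def depProdBaseChange {b a y x : E} {g : b ⟶ a} {k : y ⟶ x} {β : b ⟶ y} {α : a ⟶ x}
    (hg : IsPowerful g) (hk : IsPowerful k) (sq : g ≫ α = β ≫ k) (w : Over y) :
    (Over.pullback α).obj ((depProd hk).obj w) ⟶ (depProd hg).obj ((Over.pullback β).obj w) :=
  depProdTranspose hg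
    (Over.homMk
      (pullback.lift
        (pullback.lift
            (pullback.fst (pullback.snd ((depProd hk).obj w).hom α) g ≫
              pullback.fst ((depProd hk).obj w).hom α)
            (pullback.snd (pullback.snd ((depProd hk).obj w).hom α) g ≫ β)
            (by
              rw [Category.assoc, Category.assoc, pullback.condition, ← sq,
                ← Category.assoc, pullback.condition, Category.assoc]) ≫
          (depProdEv hk w).left)
        (pullback.snd (pullback.snd ((depProd hk).obj w).hom α) g)
        (by
          have h : (depProdEv hk w).left ≫ w.hom = pullback.snd ((depProd hk).obj w).hom k :=
            Over.w (depProdEv hk w)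
          rw [Category.assoc, h]
          exact pullback.lift_snd _ _ _))
      (pullback.lift_snd _ _ _))

end Comparison

/-! ## Generalised inverse categories and matching objects -/

/-- A *generalised inverse structure* on a category: non-isomorphisms strictly lower the degree, and
isomorphisms preserve it. -/
structure GeneralisedInverseStructure (I : Type u₁) [Category.{v₁} I] where
  /-- The degree of an object. -/
  deg : I → ℕ
  deg_lt : ∀ {i j : I} (f : i ⟶ j), ¬ IsIso f → deg j < deg i
  deg_eq : ∀ {i j : I} (f : i ⟶ j), IsIso f → deg i = deg j

namespace GeneralisedInverseStructure

variable {I : Type u₁} [Category.{v₁} I] (S : GeneralisedInverseStructure I)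

/-- The groupoid `G_n(I)` of objects of degree `n` and isomorphisms between them. -/
abbrev Stratum (n : ℕ) : Type _ :=
  Core (ObjectProperty.FullSubcategory fun i : I => S.deg i = n)

/-- `I⁻(i)`: the full subcategory of the under category `i/I` on the maps `i ⟶ j` that strictly
lower the degree. -/
abbrev Below (i : I) : Type _ :=
  ObjectProperty.FullSubcategory fun x : Under i => S.deg x.right < S.deg i

/-- The projection `I⁻(i) ⥤ I`, `(i ⟶ j) ↦ j`. -/
abbrev belowProj (i : I) : S.Below i ⥤ I :=
  ObjectProperty.ι _ ⋙ Under.forget i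

variable (E : Type u₂) [Category.{v₂} E]

/-- The matching object functor at `i`, sending `X : I ⥤ E` to
`M_i X = lim (I⁻(i) ⥤ I ⥤ E)`. -/
def matching (i : I) [HasLimitsOfShape (S.Below i) E] : (I ⥤ E) ⥤ E :=
  (Functor.whiskeringLeft _ _ E).obj (S.belowProj i) ⋙ lim

instance (i : I) [HasLimitsOfShape (S.Below i) E] [HasPullbacks E] :
    PreservesLimitsOfShape WalkingCospan (S.matching E i) := by
  unfold matching
  infer_instance

/-- The cone with apex `X i` over `I⁻(i) ⥤ I ⥤ E` whose leg at `h : i ⟶ j` is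
`X h : X i ⟶ X j`. -/
abbrev matchingCone (i : I) (X : I ⥤ E) : Cone (S.belowProj i ⋙ X) where
  pt := X.obj i
  π :=
    { app := fun x => X.map x.obj.hom
      naturality := fun x y t => by simp [← X.map_comp] }

/-- The matching map `m_i X : X i ⟶ M_i X`, natural in `X`. -/
def matchingMap (i : I) [HasLimitsOfShape (S.Below i) E] :
    (evaluation I E).obj i ⟶ S.matching E i where
  app X := limit.lift (S.belowProj i ⋙ X) (S.matchingCone E i X)
  naturality X Y t := by
    refine limit.hom_ext fun x => ?_
    have h₁ := limit.lift_π (S.matchingCone E i Y) x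
    have h₂ := limit.lift_π (S.matchingCone E i X) x
    have h₃ := limMap_π (Functor.whiskerLeft (S.belowProj i) t) x
    exact (Category.assoc _ _ _).trans <| (congrArg (t.app i ≫ ·) h₁).trans <|
      (t.naturality x.obj.hom).symm.trans <| ((congrArg (· ≫ t.app x.obj.right) h₂.symm).trans
        (Category.assoc _ _ _)).trans <| (congrArg (_ ≫ ·) h₃.symm).trans
        (Category.assoc _ _ _).symm

variable {E} [HasPullbacks E]

/-- For `p : X ⟶ A` in `E^I`, the map `(p_i, m_i X) : X i ⟶ A i ×_{M_i A} M_i X` over `A i`. -/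
def relMatchingMap {A : I ⥤ E} (X : Over A) (i : I) [HasLimitsOfShape (S.Below i) E] :
    Over.mk (X.hom.app i) ⟶
      (Over.pullback ((S.matchingMap E i).app A)).obj (Over.mk ((S.matching E i).map X.hom)) :=
  Over.homMk
    (pullback.lift ((S.matchingMap E i).app X.left) (X.hom.app i)
      ((S.matchingMap E i).naturality X.hom).symm)
    (pullback.lift_snd _ _ _)

end GeneralisedInverseStructure

end

-- Let `P` denote the sought dependent product of `g : Z ⟶ B` along `f`. A map `d ⟶ P i` must amount
-- to an element of `A i` at stage `d` together with values in `Z j` at all elements of `B j` over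
-- its image under `h : i ⟶ j`, natural in the stage and in `j`. Such data (`ProdSection`) make
-- sense before `P` exists, and the task is to represent them for each `i`.
--
-- A map that does not lower the degree is an isomorphism, and naturality fixes the values along an
-- isomorphism from those at `𝟙 i`. So a section at `i` amounts to its base, its values at `𝟙 i`,
-- and a compatible family of sections over `I⁻(i)`, subject to one agreement condition
-- (`ext_of_push`, `exists_glue`). If the sections below `i` are represented, and `L` is the limit
-- of the representing objects, then base and family form a map to `A i ×_{M_i A} L`, the values at
-- `𝟙 i` form a map to `Π_{B i} (Z i)`, and the condition says that the two agree in `Π_{B i} (B i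
-- ×_{M_i B} M_i Z)`. Hence the pullback represents sections at `i` (`exists_universal`), and
-- induction on the degree reaches every `i` (`exists_isUniversal`).
--
-- Uniqueness of classifying maps turns the representing objects into a functor, whose evaluation
-- map is terminal among maps from pullbacks along `f` to `g`; this is the right adjoint. The same
-- analysis with `L = M_i P` yields the matching square (`MatchingBoundary.isPullback`), once the
-- stated bottom map is shown to have the expected values (`depProdAp_matching_bottom`).

universe v₃ u₃

noncomputable section

/-! ### Dependent products in `E`, handled through generalised elements. -/

section DependentProductElements

variable {E : Type u₂} [Category.{v₂} E] [HasPullbacks E] {b a : E} {k : b ⟶ a}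
  (hk : IsPowerful k) {w : Over b}

/-- Evaluation of a generalised element of `Π_k w` at a generalised element of `b`. -/
def depProdAp {e : E} (t : e ⟶ ((depProd hk).obj w).left) (y : e ⟶ b)
    (h : t ≫ ((depProd hk).obj w).hom = y ≫ k) : e ⟶ w.left :=
  pullback.lift t y h ≫ (depProdEv hk w).left

theorem depProdAp_hom {e : E} (t : e ⟶ ((depProd hk).obj w).left) (y : e ⟶ b)
    (h : t ≫ ((depProd hk).obj w).hom = y ≫ k) : depProdAp hk t y h ≫ w.hom = y := by
  have h' : (depProdEv hk w).left ≫ w.hom = pullback.snd ((depProd hk).obj w).hom k :=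
    Over.w (depProdEv hk w)
  rw [depProdAp, Category.assoc, h']
  exact pullback.lift_snd _ _ _

theorem comp_depProdAp {e e' : E} (z : e' ⟶ e) (t : e ⟶ ((depProd hk).obj w).left) (y : e ⟶ b)
    (h : t ≫ ((depProd hk).obj w).hom = y ≫ k) :
    z ≫ depProdAp hk t y h = depProdAp hk (z ≫ t) (z ≫ y) (by simp only [Category.assoc, h]) := by
  rw [depProdAp, depProdAp, ← Category.assoc]
  refine congrArg (· ≫ (depProdEv hk w).left) ?_
  exact (pullback.hom_ext
    ((Category.assoc _ _ _).trans ((congrArg (z ≫ ·) (pullback.lift_fst _ _ _)).trans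
      (pullback.lift_fst _ _ _).symm))
    ((Category.assoc _ _ _).trans ((congrArg (z ≫ ·) (pullback.lift_snd _ _ _)).trans
      (pullback.lift_snd _ _ _).symm)))

theorem depProdAp_congr {e : E} {t t' : e ⟶ ((depProd hk).obj w).left} {y y' : e ⟶ b}
    (ht : t = t') (hy : y = y') (h : t ≫ ((depProd hk).obj w).hom = y ≫ k) :
    depProdAp hk t y h = depProdAp hk t' y' (by rw [← ht, ← hy, h]) := by
  subst ht hy; rfl

theorem depProdAp_hom_left {e : E} {d : Over a} (x : e ⟶ d.left) (s : d ⟶ (depProd hk).obj w)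
    (y : e ⟶ b) (h : (x ≫ s.left) ≫ ((depProd hk).obj w).hom = y ≫ k) :
    depProdAp hk (x ≫ s.left) y h =
      pullback.lift x y (by rw [← h, Category.assoc, Over.w]) ≫
        (((depProdAdj hk).homEquiv d w).symm s).left := by
  rw [Adjunction.homEquiv_counit, Over.comp_left, ← Category.assoc]
  refine congrArg (· ≫ (depProdEv hk w).left) ?_
  refine pullback.hom_ext ((pullback.lift_fst _ _ _).trans ?_) ((pullback.lift_snd _ _ _).trans ?_)
  · refine ((Category.assoc _ _ _).trans ((congrArg (_ ≫ ·) (pullback.lift_fst _ _ _)).trans ?_)).symm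
    exact (Category.assoc _ _ _).symm.trans (congrArg (· ≫ s.left) (pullback.lift_fst _ _ _))
  · refine ((Category.assoc _ _ _).trans ((congrArg (_ ≫ ·) (pullback.lift_snd _ _ _)).trans ?_)).symm
    exact pullback.lift_snd _ _ _

theorem depProdAp_transpose {e : E} {d : Over a} (u : (Over.pullback k).obj d ⟶ w)
    (x : e ⟶ d.left) (y : e ⟶ b)
    (h : (x ≫ (depProdTranspose hk u).left) ≫ ((depProd hk).obj w).hom = y ≫ k) :
    depProdAp hk (x ≫ (depProdTranspose hk u).left) y h =
      pullback.lift x y (by rw [← h, Category.assoc, Over.w]) ≫ u.left := by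
  rw [depProdAp_hom_left]
  exact congrArg (fun v : (Over.pullback k).obj d ⟶ w => _ ≫ v.left)
    (Equiv.symm_apply_apply ((depProdAdj hk).homEquiv d w) u)

theorem depProdAp_map {w' : Over b} (u : w ⟶ w') {e : E} (t : e ⟶ ((depProd hk).obj w).left)
    (y : e ⟶ b) (h : (t ≫ ((depProd hk).map u).left) ≫ ((depProd hk).obj w').hom = y ≫ k) :
    depProdAp hk (t ≫ ((depProd hk).map u).left) y h =
      depProdAp hk t y (by rw [← h, Category.assoc, Over.w]) ≫ u.left := by
  refine (depProdAp_hom_left hk t _ y h).trans ((congrArg (_ ≫ ·) ?_).trans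
    (Category.assoc _ _ _).symm)
  rw [Adjunction.homEquiv_counit]
  exact congrArg (·.left) ((depProdAdj hk).counit_naturality u)

/-- Extensionality: by adjunction it suffices to compare values at the generic element, the pair of
projections of `d ×_a b`. -/
theorem depProd_hom_ext {d : E} {t t' : d ⟶ ((depProd hk).obj w).left}
    (h : t ≫ ((depProd hk).obj w).hom = t' ≫ ((depProd hk).obj w).hom)
    (h' : ∀ ⦃e : E⦄ (x : e ⟶ d) (y : e ⟶ b) (hxy : (x ≫ t) ≫ ((depProd hk).obj w).hom = y ≫ k),
      depProdAp hk (x ≫ t) y hxy =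
        depProdAp hk (x ≫ t') y (by rw [← hxy, Category.assoc, Category.assoc, h])) : t = t' := by
  let α : d ⟶ a := t ≫ ((depProd hk).obj w).hom
  let s : Over.mk α ⟶ (depProd hk).obj w := Over.homMk t rfl
  let s' : Over.mk α ⟶ (depProd hk).obj w := Over.homMk t' h.symm
  suffices s = s' from congrArg (·.left) this
  apply ((depProdAdj hk).homEquiv _ _).symm.injective
  ext
  have key := h' (pullback.fst α k) (pullback.snd α k)
    (by rw [Category.assoc]; exact pullback.condition)
  have e₁ := depProdAp_hom_left hk (d := Over.mk α) (pullback.fst α k) s (pullback.snd α k)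
    (by rw [Category.assoc]; exact pullback.condition)
  have e₂ := depProdAp_hom_left hk (d := Over.mk α) (pullback.fst α k) s' (pullback.snd α k)
    (by rw [Category.assoc, Over.w]; exact pullback.condition)
  have h1 : pullback.lift (pullback.fst α k) (pullback.snd α k) pullback.condition =
      𝟙 (pullback α k) := by apply pullback.hom_ext <;> simp
  erw [h1, Category.id_comp] at e₁ e₂
  exact e₁.symm.trans (key.trans e₂)

/-- A Yoneda argument: a natural family `φ` is determined by its value at the pair of projections of
`d ×_a b`, and the transpose of that value is the required map. -/
theorem exists_depProd_lift {d : E} (α : d ⟶ a)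
    (φ : ∀ ⦃e : E⦄ (x : e ⟶ d) (y : e ⟶ b), x ≫ α = y ≫ k → (e ⟶ w.left))
    (hφ : ∀ ⦃e : E⦄ (x : e ⟶ d) (y : e ⟶ b) (h : x ≫ α = y ≫ k), φ x y h ≫ w.hom = y)
    (hφ' : ∀ ⦃e e' : E⦄ (z : e' ⟶ e) (x : e ⟶ d) (y : e ⟶ b) (h : x ≫ α = y ≫ k),
      φ (z ≫ x) (z ≫ y) (by simp only [Category.assoc, h]) = z ≫ φ x y h) :
    ∃ t : d ⟶ ((depProd hk).obj w).left, ∃ ht : t ≫ ((depProd hk).obj w).hom = α,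
      ∀ ⦃e : E⦄ (x : e ⟶ d) (y : e ⟶ b) (h : x ≫ α = y ≫ k),
        depProdAp hk (x ≫ t) y (by rw [Category.assoc, ht, h]) = φ x y h := by
  let u : (Over.pullback k).obj (Over.mk α) ⟶ w :=
    Over.homMk (φ (pullback.fst α k) (pullback.snd α k) pullback.condition) (hφ _ _ _)
  refine ⟨(depProdTranspose hk u).left, Over.w (depProdTranspose hk u), fun e x y h => ?_⟩
  refine (depProdAp_transpose hk (d := Over.mk α) u x y _).trans ?_
  refine (hφ' _ _ _ _).symm.trans ?_
  congr 1
  · exact pullback.lift_fst _ _ _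
  · exact pullback.lift_snd _ _ _

end DependentProductElements
end

/-! ### Sections: the dependent product in `E^I` as a presheaf, and its representing objects. -/

section

variable {I : Type u₁} [Category.{v₁} I] {E : Type u₂} [Category.{v₂} E] {A B Z : I ⥤ E}

/-- A generalised element, with domain `d`, of the value at `i` of the dependent product along
`f : B ⟶ A` of `g : Z ⟶ B`, expressed without assuming that the dependent product exists. -/
structure ProdSection (f : B ⟶ A) (g : Z ⟶ B) (i : I) (d : E) where
  /-- The underlying generalised element of `A i`. -/
  base : d ⟶ A.obj i
  /-- The value at a generalised element of `B j` over the image of `base` in `A j`. -/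
  val : ∀ ⦃j : I⦄ (h : i ⟶ j) ⦃e : E⦄ (x : e ⟶ d) (y : e ⟶ B.obj j),
    x ≫ base ≫ A.map h = y ≫ f.app j → (e ⟶ Z.obj j)
  val_app : ∀ ⦃j : I⦄ (h : i ⟶ j) ⦃e : E⦄ (x : e ⟶ d) (y : e ⟶ B.obj j)
    (w : x ≫ base ≫ A.map h = y ≫ f.app j), val h x y w ≫ g.app j = y
  val_comp : ∀ ⦃j : I⦄ (h : i ⟶ j) ⦃e e' : E⦄ (z : e' ⟶ e) (x : e ⟶ d) (y : e ⟶ B.obj j)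
    (w : x ≫ base ≫ A.map h = y ≫ f.app j),
    val h (z ≫ x) (z ≫ y) (by simp only [Category.assoc, w]) = z ≫ val h x y w
  val_map : ∀ ⦃j j' : I⦄ (h : i ⟶ j) (k : j ⟶ j') ⦃e : E⦄ (x : e ⟶ d) (y : e ⟶ B.obj j)
    (w : x ≫ base ≫ A.map h = y ≫ f.app j),
    val (h ≫ k) x (y ≫ B.map k)
      (by rw [Category.assoc, f.naturality, ← Category.assoc y, ← w]; simp) = val h x y w ≫ Z.map k

namespace ProdSection

variable {f : B ⟶ A} {g : Z ⟶ B} {i : I} {d : E}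

theorem ext {s s' : ProdSection f g i d} (hb : s.base = s'.base)
    (hv : ∀ ⦃j : I⦄ (h : i ⟶ j) ⦃e : E⦄ (x : e ⟶ d) (y : e ⟶ B.obj j)
      (w : x ≫ s.base ≫ A.map h = y ≫ f.app j),
      s.val h x y w = s'.val h x y (by rw [← hb, w])) : s = s' := by
  obtain ⟨a, φ, _, _, _⟩ := s
  obtain ⟨a', φ', _, _, _⟩ := s'
  obtain rfl : a = a' := hb
  obtain rfl : φ = φ' := by
    funext j h e x y w
    exact hv h x y w
  rfl

theorem val_congr (s : ProdSection f g i d) {j : I} {h h' : i ⟶ j} (hh : h = h') {e : E}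
    {x x' : e ⟶ d} (hx : x = x') {y y' : e ⟶ B.obj j} (hy : y = y')
    (w : x ≫ s.base ≫ A.map h = y ≫ f.app j) :
    s.val h x y w = s.val h' x' y' (by rw [← hh, ← hx, ← hy, w]) := by
  subst hh hx hy; rfl

theorem val_eq {s s' : ProdSection f g i d} (hs : s = s') {j : I} (h : i ⟶ j) {e : E}
    (x : e ⟶ d) (y : e ⟶ B.obj j) (w : x ≫ s.base ≫ A.map h = y ≫ f.app j) :
    s.val h x y w = s'.val h x y (by rw [← hs, w]) := by
  subst hs; rfl

/-- Precomposition of a generalised element. -/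
@[simps]
def comp {d' : E} (z : d' ⟶ d) (s : ProdSection f g i d) : ProdSection f g i d' where
  base := z ≫ s.base
  val j h e x y w := s.val h (x ≫ z) y (by rw [← w]; simp)
  val_app j h e x y w := s.val_app h _ y _
  val_comp j h e e' z' x y w := by
    rw [← s.val_comp]
    exact s.val_congr rfl (Category.assoc _ _ _) rfl _
  val_map j j' h k e x y w := s.val_map h k _ y _

/-- The functorial action of `I` on generalised elements. -/
@[simps]
def push {j : I} (h : i ⟶ j) (s : ProdSection f g i d) : ProdSection f g j d where
  base := s.base ≫ A.map h
  val j' k e x y w := s.val (h ≫ k) x y (by rw [← w]; simp)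
  val_app j' k e x y w := s.val_app (h ≫ k) x y _
  val_comp j' k e e' z x y w := s.val_comp (h ≫ k) z x y _
  val_map j' j'' k l e x y w := by
    rw [← s.val_map]
    exact s.val_congr (Category.assoc _ _ _).symm rfl rfl _

theorem comp_comp {d' d'' : E} (z' : d'' ⟶ d') (z : d' ⟶ d) (s : ProdSection f g i d) :
    (s.comp z).comp z' = s.comp (z' ≫ z) :=
  ext (by simp) fun j h e x y w => s.val_congr rfl (by simp) rfl _

theorem id_comp (s : ProdSection f g i d) : s.comp (𝟙 d) = s :=
  ext (by simp) fun j h e x y w => s.val_congr rfl (by simp) rfl _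

theorem push_push {j j' : I} (h : i ⟶ j) (k : j ⟶ j') (s : ProdSection f g i d) :
    (s.push h).push k = s.push (h ≫ k) :=
  ext (by simp) fun j h e x y w => s.val_congr (by simp) rfl rfl _

theorem push_id (s : ProdSection f g i d) : s.push (𝟙 i) = s :=
  ext (by simp) fun j h e x y w => s.val_congr (by simp) rfl rfl _

theorem comp_push {d' : E} (z : d' ⟶ d) {j : I} (h : i ⟶ j) (s : ProdSection f g i d) :
    (s.push h).comp z = (s.comp z).push h :=
  ext (by simp) fun j h e x y w => rfl

theorem push_val_id {j : I} (h : i ⟶ j) (s : ProdSection f g i d) {e : E} (x : e ⟶ d)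
    (y : e ⟶ B.obj j) (w : x ≫ (s.base ≫ A.map h) ≫ A.map (𝟙 j) = y ≫ f.app j) :
    (s.push h).val (𝟙 j) x y w = s.val h x y (by rw [← w]; simp) :=
  s.val_congr (Category.comp_id h) rfl rfl _

theorem val_comp_eq {i j : I} {d d' : E} {h : i ⟶ j} {v : ProdSection f g i d}
    {v' : ProdSection f g j d'} {m : d ⟶ d'} (hm : v'.comp m = v.push h) {e : E} (x : e ⟶ d)
    (y : e ⟶ B.obj j) (w : (x ≫ m) ≫ v'.base ≫ A.map (𝟙 j) = y ≫ f.app j)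
    (w' : x ≫ v.base ≫ A.map h = y ≫ f.app j) :
    v'.val (𝟙 j) (x ≫ m) y w = v.val h x y w' := by
  have w₁ : x ≫ (v'.comp m).base ≫ A.map (𝟙 j) = y ≫ f.app j := by rw [← w]; simp
  refine (val_eq hm (𝟙 j) x y w₁).trans ?_
  exact v.val_congr (Category.comp_id h) rfl rfl _

/-- A section is universal if it represents the presheaf of sections. -/
def IsUniversal (u : ProdSection f g i d) : Prop :=
  ∀ ⦃e : E⦄, Function.Bijective fun z : e ⟶ d => u.comp z

section Lift

variable {u : ProdSection f g i d} {e : E}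

/-- The generalised element classified by a section. -/
noncomputable def IsUniversal.lift (hu : u.IsUniversal) (s : ProdSection f g i e) : e ⟶ d :=
  ((hu (e := e)).surjective s).choose

@[simp]
theorem IsUniversal.comp_lift (hu : u.IsUniversal) (s : ProdSection f g i e) : u.comp (hu.lift s) = s :=
  ((hu (e := e)).surjective s).choose_spec

theorem IsUniversal.hom_ext (hu : u.IsUniversal) {z z' : e ⟶ d} (h : u.comp z = u.comp z') : z = z' :=
  hu.injective h

/-- Allows universality to be carried from a constructed dependent product to the one chosen by
`depProd`. -/
theorem IsUniversal.of_isIso (hu : u.IsUniversal) (z : e ⟶ d) [IsIso z] : (u.comp z).IsUniversal := by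
  refine fun e' => ⟨fun t t' h => ?_, fun s => ⟨hu.lift s ≫ inv z, ?_⟩⟩
  · simp only [comp_comp] at h
    exact (cancel_mono z).1 (hu.hom_ext h)
  · simp [comp_comp]

end Lift

end ProdSection

/-- The functor whose values are given representing objects of the presheaves of sections. -/
@[simps]
noncomputable def sectionFunctor {f : B ⟶ A} {g : Z ⟶ B} {J : Type u₃} [Category.{v₃} J] (q : J ⥤ I)
    (r : J → E) (u : ∀ x, ProdSection f g (q.obj x) (r x)) (hu : ∀ x, (u x).IsUniversal) :
    J ⥤ E where
  obj := r
  map {x y} t := (hu y).lift ((u x).push (q.map t))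
  map_id x := (hu x).hom_ext (by simp [ProdSection.push_id, ProdSection.id_comp])
  map_comp {x y z} t t' := (hu z).hom_ext (by
    simp [← ProdSection.comp_comp, ProdSection.comp_push, ProdSection.push_push])

end

/-! ### Decomposing and gluing sections according to degree. -/

namespace ProdSection

variable {I : Type u₁} [Category.{v₁} I] (S : GeneralisedInverseStructure I)
  {E : Type u₂} [Category.{v₂} E] {A B Z : I ⥤ E} {f : B ⟶ A} {g : Z ⟶ B} {i : I} {d : E}

/-- Apply `val_map` to `𝟙 i` followed by `h`, with `y` transported back along `inv h`. This disposes
of all maps that do not lower the degree. -/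
theorem val_eq_of_isIso (s : ProdSection f g i d) {j : I} (h : i ⟶ j) [IsIso h] {e : E}
    (x : e ⟶ d) (y : e ⟶ B.obj j) (w : x ≫ s.base ≫ A.map h = y ≫ f.app j) :
    s.val h x y w = s.val (𝟙 i) x (y ≫ B.map (inv h))
      (by rw [Category.assoc, f.naturality, ← Category.assoc y, ← w]; simp) ≫
        Z.map h := by
  rw [← s.val_map]
  exact s.val_congr (by simp) rfl (by simp) _

/-- A section is determined by its base, its value at the identity, and its images under
the maps that strictly lower the degree. -/
theorem ext_of_push {s s' : ProdSection f g i d} (hb : s.base = s'.base)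
    (hv : ∀ ⦃e : E⦄ (x : e ⟶ d) (y : e ⟶ B.obj i) (w : x ≫ s.base ≫ A.map (𝟙 i) = y ≫ f.app i),
      s.val (𝟙 i) x y w = s'.val (𝟙 i) x y (by rw [← hb, w]))
    (hp : ∀ ⦃j : I⦄ (h : i ⟶ j), S.deg j < S.deg i → s.push h = s'.push h) : s = s' := by
  refine ext hb fun j h e x y w => ?_
  by_cases hd : S.deg j < S.deg i
  · have w' : x ≫ (s.base ≫ A.map h) ≫ A.map (𝟙 j) = y ≫ f.app j := by rw [← w]; simp
    exact (s.push_val_id h x y w').symm.trans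
      ((val_eq (hp h hd) (𝟙 j) x y w').trans (s'.push_val_id h x y _))
  · have : IsIso h := by
      by_contra hn
      exact hd (S.deg_lt h hn)
    rw [val_eq_of_isIso s h x y w, val_eq_of_isIso s' h x y, hv]

/-- Sections are glued from a base, a value at the identity, and compatible images
under the maps that strictly lower the degree. -/
theorem exists_glue (a : d ⟶ A.obj i)
    (t : ∀ ⦃e : E⦄ (x : e ⟶ d) (y : e ⟶ B.obj i), x ≫ a = y ≫ f.app i → (e ⟶ Z.obj i))
    (t_app : ∀ ⦃e : E⦄ (x : e ⟶ d) (y : e ⟶ B.obj i) (w : x ≫ a = y ≫ f.app i),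
      t x y w ≫ g.app i = y)
    (t_comp : ∀ ⦃e e' : E⦄ (z : e' ⟶ e) (x : e ⟶ d) (y : e ⟶ B.obj i) (w : x ≫ a = y ≫ f.app i),
      t (z ≫ x) (z ≫ y) (by simp only [Category.assoc, w]) = z ≫ t x y w)
    (σ : ∀ ⦃j : I⦄ (_ : i ⟶ j), S.deg j < S.deg i → ProdSection f g j d)
    (σ_base : ∀ ⦃j : I⦄ (h : i ⟶ j) (hd : S.deg j < S.deg i), (σ h hd).base = a ≫ A.map h)
    (σ_push : ∀ ⦃j j' : I⦄ (h : i ⟶ j) (k : j ⟶ j') (hd : S.deg j < S.deg i)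
      (hd' : S.deg j' < S.deg i), (σ h hd).push k = σ (h ≫ k) hd')
    (compat : ∀ ⦃j : I⦄ (h : i ⟶ j) (hd : S.deg j < S.deg i) ⦃e : E⦄ (x : e ⟶ d)
      (y : e ⟶ B.obj i) (w : x ≫ a = y ≫ f.app i),
      (σ h hd).val (𝟙 j) x (y ≫ B.map h) (by
        rw [σ_base, A.map_id, Category.comp_id, Category.assoc, f.naturality, ← Category.assoc y,
          ← w, Category.assoc]) =
        t x y w ≫ Z.map h) :
    ∃ (s : ProdSection f g i d) (hb : s.base = a),
      (∀ ⦃e : E⦄ (x : e ⟶ d) (y : e ⟶ B.obj i) (w : x ≫ a = y ≫ f.app i),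
        s.val (𝟙 i) x y (by rw [hb, ← w]; simp) = t x y w) ∧
      ∀ ⦃j : I⦄ (h : i ⟶ j) (hd : S.deg j < S.deg i), s.push h = σ h hd := by
  classical
  have iso : ∀ {j : I} (h : i ⟶ j), ¬ S.deg j < S.deg i → IsIso h := fun h hd => by
    by_contra hn
    exact hd (S.deg_lt h hn)
  -- Degrees never increase along a map, so a composite starting with a degree-lowering map lowers
  -- the degree.
  have le : ∀ {j j' : I} (k : j ⟶ j'), S.deg j' ≤ S.deg j := fun k => by
    by_cases hk : IsIso k
    · exact (S.deg_eq k hk).ge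
    · exact (S.deg_lt k hk).le
  have ht : ∀ {e : E} {x x' : e ⟶ d} {y y' : e ⟶ B.obj i} (_ : x = x') (_ : y = y')
      (w : x ≫ a = y ≫ f.app i) (w' : x' ≫ a = y' ≫ f.app i), t x y w = t x' y' w' := by
    rintro e x _ y _ rfl rfl w w'; rfl
  have winv : ∀ {j : I} (h : i ⟶ j) [IsIso h] {e : E} (x : e ⟶ d) (y : e ⟶ B.obj j)
      (_ : x ≫ a ≫ A.map h = y ≫ f.app j), x ≫ a = (y ≫ B.map (inv h)) ≫ f.app i := by
    intro j h _ e x y w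
    rw [Category.assoc, f.naturality, ← Category.assoc y, ← w]; simp
  have wσ : ∀ {j : I} (h : i ⟶ j) (hd : S.deg j < S.deg i) {e : E} (x : e ⟶ d) (y : e ⟶ B.obj j)
      (_ : x ≫ a ≫ A.map h = y ≫ f.app j),
      x ≫ (σ h hd).base ≫ A.map (𝟙 j) = y ≫ f.app j := by
    intro j h hd e x y w
    rw [σ_base, ← w]; simp
  -- Values along degree-lowering maps are read off from `σ`; along the other maps, which are
  -- isomorphisms, they are forced by `t`.
  let v : ∀ ⦃j : I⦄ (h : i ⟶ j) ⦃e : E⦄ (x : e ⟶ d) (y : e ⟶ B.obj j),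
      x ≫ a ≫ A.map h = y ≫ f.app j → (e ⟶ Z.obj j) := fun j h e x y w =>
    if hd : S.deg j < S.deg i then (σ h hd).val (𝟙 j) x y (wσ h hd x y w)
    else haveI := iso h hd
      t x (y ≫ B.map (inv h)) (winv h x y w) ≫ Z.map h
  have v_pos : ∀ {j : I} (h : i ⟶ j) {e : E} (x : e ⟶ d) (y : e ⟶ B.obj j)
      (w : x ≫ a ≫ A.map h = y ≫ f.app j) (hd : S.deg j < S.deg i),
      v h x y w = (σ h hd).val (𝟙 j) x y (wσ h hd x y w) := fun h e x y w hd => dif_pos hd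
  have v_neg : ∀ {j : I} (h : i ⟶ j) {e : E} (x : e ⟶ d) (y : e ⟶ B.obj j)
      (w : x ≫ a ≫ A.map h = y ≫ f.app j) (hd : ¬ S.deg j < S.deg i) [IsIso h],
      v h x y w = t x (y ≫ B.map (inv h)) (winv h x y w) ≫ Z.map h :=
    fun h e x y w hd _ => dif_neg hd
  refine ⟨⟨a, v, ?_, ?_, ?_⟩, rfl, ?_, ?_⟩
  · intro j h e x y w
    by_cases hd : S.deg j < S.deg i
    · rw [v_pos h x y w hd, val_app]
    · have := iso h hd
      rw [v_neg h x y w hd, Category.assoc, g.naturality, ← Category.assoc, t_app]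
      simp
  · intro j h e e' z x y w
    have w' : (z ≫ x) ≫ a ≫ A.map h = (z ≫ y) ≫ f.app j := by simp only [Category.assoc, w]
    by_cases hd : S.deg j < S.deg i
    · rw [v_pos h x y w hd, v_pos h _ _ w' hd, val_comp]
    · have := iso h hd
      rw [v_neg h x y w hd, v_neg h _ _ w' hd, ← Category.assoc, ← t_comp]
      exact congrArg (· ≫ Z.map h) (ht rfl (Category.assoc _ _ _) _ _)
  · intro j j' h k e x y w
    have w' : x ≫ a ≫ A.map (h ≫ k) = (y ≫ B.map k) ≫ f.app j' := by
      rw [Category.assoc, f.naturality, ← Category.assoc y, ← w]; simp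
    by_cases hd : S.deg j < S.deg i
    · have hd' := (le k).trans_lt hd
      rw [v_pos h x y w hd, v_pos (h ≫ k) _ _ w' hd', ← val_map,
        val_eq (σ_push h k hd hd').symm]
      exact val_congr _ ((Category.comp_id k).trans (Category.id_comp k).symm) rfl rfl _
    · have := iso h hd
      by_cases hd' : S.deg j' < S.deg i
      -- The mixed case: `h` is invertible but `h ≫ k` lowers the degree. Only here do `t` and `σ`
      -- meet, through `compat`.
      · rw [v_neg h x y w hd, v_pos (h ≫ k) _ _ w' hd', Category.assoc, ← Z.map_comp,
          ← compat (h ≫ k) hd']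
        exact val_congr _ rfl rfl (by simp) _
      · have := iso (h ≫ k) hd'
        rw [v_neg h x y w hd, v_neg (h ≫ k) _ _ w' hd', Category.assoc (t x _ _), ← Z.map_comp]
        have : IsIso k := IsIso.of_isIso_comp_left h k
        exact congrArg (· ≫ Z.map (h ≫ k)) (ht rfl (by simp) _ _)
  · intro e x y w
    have hd : ¬ S.deg i < S.deg i := lt_irrefl _
    have w' : x ≫ a ≫ A.map (𝟙 i) = y ≫ f.app i := by rw [A.map_id, Category.comp_id, w]
    refine (v_neg (𝟙 i) x y w' hd).trans ?_
    rw [Z.map_id, Category.comp_id]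
    exact ht rfl (by simp) _ _
  · intro j h hd
    refine ext (σ_base h hd).symm fun j' k e x y w => ?_
    have hd' := (le k).trans_lt hd
    have w' : x ≫ a ≫ A.map (h ≫ k) = y ≫ f.app j' := by rw [← w]; simp
    refine (v_pos (h ≫ k) x y w' hd').trans ?_
    exact (val_eq (σ_push h k hd hd').symm _ _ _ _).trans (push_val_id _ _ _ _ _)

end ProdSection

/-! ### Matching objects, and the pullback square characterising sections at `i`. -/

noncomputable section

section

variable {I : Type u₁} [Category.{v₁} I] (S : GeneralisedInverseStructure I)
  {E : Type u₂} [Category.{v₂} E]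

namespace GeneralisedInverseStructure

section Matching

variable {i : I} [HasLimitsOfShape (S.Below i) E]

/-- The projections of the matching object. -/
def matchingProj (X : I ⥤ E) (h : S.Below i) : (S.matching E i).obj X ⟶ X.obj h.obj.right :=
  limit.π (S.belowProj i ⋙ X) h

theorem matchingProj_map (X : I ⥤ E) {h h' : S.Below i} (k : h ⟶ h') :
    S.matchingProj X h ≫ X.map ((S.belowProj i).map k) = S.matchingProj X h' :=
  limit.w (S.belowProj i ⋙ X) k

theorem matching_map_proj {X Y : I ⥤ E} (t : X ⟶ Y) (h : S.Below i) :
    (S.matching E i).map t ≫ S.matchingProj Y h = S.matchingProj X h ≫ t.app h.obj.right :=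
  limMap_π (Functor.whiskerLeft (S.belowProj i) t) h

theorem matchingMap_proj (X : I ⥤ E) (h : S.Below i) :
    (S.matchingMap E i).app X ≫ S.matchingProj X h = X.map h.obj.hom :=
  limit.lift_π (S.matchingCone E i X) h

theorem matching_hom_ext {X : I ⥤ E} {e : E} {z z' : e ⟶ (S.matching E i).obj X}
    (w : ∀ h : S.Below i, z ≫ S.matchingProj X h = z' ≫ S.matchingProj X h) : z = z' :=
  limit.hom_ext w

end Matching

end GeneralisedInverseStructure

variable {A B Z : I ⥤ E} (f : B ⟶ A) (g : Z ⟶ B) (i : I) [HasLimitsOfShape (S.Below i) E]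

/-- The values of a dependent product below `i`, with their universal sections, and their
limit. -/
structure BelowCone where
  /-- The values of the dependent product below `i`. -/
  W : S.Below i ⥤ E
  /-- The universal sections. -/
  u : ∀ h : S.Below i, ProdSection f g h.obj.right (W.obj h)
  univ : ∀ h, (u h).IsUniversal
  comp_map : ∀ {h h' : S.Below i} (k : h ⟶ h'),
    (u h').comp (W.map k) = (u h).push k.hom.right
  /-- The matching object. -/
  L : E
  /-- The projections of the matching object. -/
  π : ∀ h, L ⟶ W.obj h
  π_map : ∀ {h h' : S.Below i} (k : h ⟶ h'), π h ≫ W.map k = π h'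
  -- The limit property is stated by elements so that `L` may be either the limit of chosen
  -- representing objects or the matching object of an actual dependent product.
  exists_lift : ∀ {e : E} (z : ∀ h, e ⟶ W.obj h) (_ : ∀ {h h' : S.Below i} (k : h ⟶ h'),
    z h ≫ W.map k = z h'), ∃ z' : e ⟶ L, ∀ h, z' ≫ π h = z h
  hom_ext : ∀ {e : E} {z z' : e ⟶ L}, (∀ h, z ≫ π h = z' ≫ π h) → z = z'
  /-- The projection to the matching object of `A`. -/
  μ : L ⟶ (S.matching E i).obj A
  μ_proj : ∀ h, μ ≫ S.matchingProj A h = π h ≫ (u h).base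

variable {f g i} [HasPullbacks E]

namespace BelowCone

variable {S} (D : BelowCone S f g i)

/-- The fibre product `A i ×_{M_i A} L`. -/
abbrev P : E := pullback D.μ ((S.matchingMap E i).app A)

theorem base_map {e : E} (x : e ⟶ D.P) (h : S.Below i) :
    (x ≫ pullback.fst _ _ ≫ D.π h) ≫ (D.u h).base = x ≫ pullback.snd _ _ ≫ A.map h.obj.hom := by
  simp only [Category.assoc]
  rw [← D.μ_proj, ← S.matchingMap_proj A h, pullback.condition_assoc]

theorem base_map_eq {e : E} {x : e ⟶ D.P} {y : e ⟶ B.obj i}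
    (w : x ≫ pullback.snd _ _ = y ≫ f.app i) (h : S.Below i) :
    (x ≫ pullback.fst _ _ ≫ D.π h) ≫ (D.u h).base ≫ A.map (𝟙 h.obj.right) =
      (y ≫ B.map h.obj.hom) ≫ f.app h.obj.right := by
  have hb := base_map D x h
  rw [A.map_id, Category.comp_id, hb, Category.assoc y, f.naturality, ← Category.assoc,
    ← Category.assoc, w]

end BelowCone

variable (g) (hf : IsPowerful (f.app i))

/-- A cone below `i` together with the map from the fibre product `A i ×_{M_i A} lim W` which, in
the presence of a dependent product, is the bottom map of its matching square at `i`. -/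
structure MatchingBoundary extends BelowCone S f g i where
  /-- The bottom map of the matching square. -/
  bot : pullback μ ((S.matchingMap E i).app A) ⟶
    ((depProd hf).obj ((Over.pullback ((S.matchingMap E i).app B)).obj
      (Over.mk ((S.matching E i).map g)))).left
  bot_hom : bot ≫ ((depProd hf).obj _).hom = pullback.snd μ ((S.matchingMap E i).app A)
  -- With `bot_hom` this pins down `bot`: a map into the dependent product is known from its values,
  -- and a map into `M_i Z` from its projections.
  bot_ap : ∀ (h : S.Below i) {e : E} (x : e ⟶ pullback μ ((S.matchingMap E i).app A))
    (y : e ⟶ B.obj i) (w : (x ≫ bot) ≫ ((depProd hf).obj _).hom = y ≫ f.app i)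
    (w' : (x ≫ pullback.fst _ _ ≫ π h) ≫ (u h).base ≫ A.map (𝟙 h.obj.right) =
      (y ≫ B.map h.obj.hom) ≫ f.app h.obj.right),
    depProdAp hf (x ≫ bot) y w ≫
      pullback.fst ((S.matching E i).map g) ((S.matchingMap E i).app B) ≫ S.matchingProj Z h =
      (u h).val (𝟙 _) (x ≫ pullback.fst _ _ ≫ π h) (y ≫ B.map h.obj.hom) w'

namespace MatchingBoundary

variable {S g hf} (D : MatchingBoundary S g hf) {d : E}

/-- The dependent product `Π_{B i} (Z i)`. -/
abbrev _root_.depProdAt (hf : IsPowerful (f.app i)) (g : Z ⟶ B) : Over (A.obj i) :=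
  (depProd hf).obj (Over.mk (g.app i))

variable (S g hf) in
/-- The right map of the matching square. -/
abbrev right : (depProdAt hf g).left ⟶
    ((depProd hf).obj ((Over.pullback ((S.matchingMap E i).app B)).obj
      (Over.mk ((S.matching E i).map g)))).left :=
  ((depProd hf).map (S.relMatchingMap (Over.mk g) i)).left

variable (S g hf) in
theorem right_hom : right S g hf ≫ ((depProd hf).obj _).hom = (depProdAt hf g).hom :=
  Over.w ((depProd hf).map (S.relMatchingMap (Over.mk g) i))

variable (S g hf) in
theorem relMatchingMap_proj (h : S.Below i) :
    (S.relMatchingMap (Over.mk g) i).left ≫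
      pullback.fst ((S.matching E i).map g) ((S.matchingMap E i).app B) ≫ S.matchingProj Z h =
    Z.map h.obj.hom := by
  refine (Category.assoc _ _ _).symm.trans (Eq.trans ?_ (S.matchingMap_proj Z h))
  exact congrArg (· ≫ S.matchingProj Z h) (pullback.lift_fst _ _ _)

theorem depProdAp_right_proj {e : E} (t : e ⟶ (depProdAt hf g).left) (y : e ⟶ B.obj i)
    (w : (t ≫ right S g hf) ≫ ((depProd hf).obj _).hom = y ≫ f.app i)
    (w' : t ≫ (depProdAt hf g).hom = y ≫ f.app i) (h : S.Below i) :
    depProdAp hf (t ≫ right S g hf) y w ≫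
      pullback.fst ((S.matching E i).map g) ((S.matchingMap E i).app B) ≫ S.matchingProj Z h =
    depProdAp hf t y w' ≫ Z.map h.obj.hom := by
  refine (congrArg (· ≫ _) (depProdAp_map hf (S.relMatchingMap (Over.mk g) i) t y w)).trans ?_
  exact (Category.assoc _ _ _).trans (congrArg (_ ≫ ·) (relMatchingMap_proj S g h))

/-- A section corresponds to a pair of generalised elements of `A i ×_{M_i A} L` and of
`Π_{B i} (Z i)`. -/
structure Matches (s : d ⟶ D.P) (t : d ⟶ (depProdAt hf g).left)
    (v : ProdSection f g i d) : Prop where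
  base : v.base = s ≫ pullback.snd _ _
  hom : t ≫ (depProdAt hf g).hom = v.base
  val : ∀ ⦃e : E⦄ (x : e ⟶ d) (y : e ⟶ B.obj i)
    (w : (x ≫ t) ≫ (depProdAt hf g).hom = y ≫ f.app i)
    (w' : x ≫ v.base ≫ A.map (𝟙 i) = y ≫ f.app i),
    depProdAp hf (x ≫ t) y w = v.val (𝟙 i) x y w'
  push : ∀ h : S.Below i, (D.u h).comp (s ≫ pullback.fst _ _ ≫ D.π h) = v.push h.obj.hom

variable {D}

theorem Matches.comp {s : d ⟶ D.P} {t : d ⟶ (depProdAt hf g).left} {v : ProdSection f g i d}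
    (m : D.Matches s t v) {d' : E} (z : d' ⟶ d) : D.Matches (z ≫ s) (z ≫ t) (v.comp z) where
  base := by simp [m.base]
  hom := by simp only [Category.assoc, m.hom, ProdSection.comp_base]
  val e x y w w' := by
    rw [depProdAp_congr hf (Category.assoc x z t).symm rfl w, m.val]
    rfl
  push h := by
    rw [← ProdSection.comp_push, ← m.push, ProdSection.comp_comp, Category.assoc]

/-- With `snd_eq`, `section_eq`, `w`, `exists_section` and `exists_matches`, this makes `Matches`
the graph of a bijection between sections at `i` and commuting pairs `(s, t)`. -/
theorem Matches.fst_eq {s s' : d ⟶ D.P} {t t' : d ⟶ (depProdAt hf g).left}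
    {v : ProdSection f g i d} (m : D.Matches s t v) (m' : D.Matches s' t' v) : s = s' := by
  refine pullback.hom_ext (D.hom_ext fun h => (D.univ h).hom_ext ?_) (m.base.symm.trans m'.base)
  simp only [Category.assoc]
  rw [m.push, m'.push]

theorem Matches.snd_eq {s s' : d ⟶ D.P} {t t' : d ⟶ (depProdAt hf g).left}
    {v : ProdSection f g i d} (m : D.Matches s t v) (m' : D.Matches s' t' v) : t = t' := by
  refine depProd_hom_ext hf (m.hom.trans m'.hom.symm) fun e x y w => ?_
  have w' : x ≫ v.base ≫ A.map (𝟙 i) = y ≫ f.app i := by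
    rw [← w, A.map_id, Category.comp_id, Category.assoc, m.hom]
  exact (m.val x y w w').trans (m'.val x y _ w').symm

theorem Matches.section_eq {s : d ⟶ D.P} {t : d ⟶ (depProdAt hf g).left}
    {v v' : ProdSection f g i d} (m : D.Matches s t v) (m' : D.Matches s t v') : v = v' := by
  refine ProdSection.ext_of_push S (m.base.trans m'.base.symm) (fun e x y w => ?_) fun j h hd => ?_
  · have w' : (x ≫ t) ≫ (depProdAt hf g).hom = y ≫ f.app i := by
      rw [← w, A.map_id, Category.comp_id, Category.assoc, m.hom]
    exact (m.val x y w' w).symm.trans (m'.val x y w' _)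
  · let h' : S.Below i := ⟨Under.mk h, hd⟩
    exact (m.push h').symm.trans (m'.push h')

/-- Compare the values at `y`, projected to the component `h` of `M_i Z`. Both are the value of `v`
along `h` at `B h` applied to `y`: on the `t` side by naturality of `v` starting from `𝟙 i`, on the
`s` side because `s` classifies the push of `v` along `h`. -/
theorem Matches.w {s : d ⟶ D.P} {t : d ⟶ (depProdAt hf g).left}
    {v : ProdSection f g i d} (m : D.Matches s t v) : t ≫ right S g hf = s ≫ D.bot := by
  have hs : (s ≫ D.bot) ≫ ((depProd hf).obj _).hom = v.base := by
    rw [Category.assoc, D.bot_hom, m.base]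
  have ht : (t ≫ right S g hf) ≫ ((depProd hf).obj _).hom = v.base := by
    rw [Category.assoc, right_hom, m.hom]
  refine depProd_hom_ext hf (ht.trans hs.symm) fun e x y w => ?_
  have w₀ : x ≫ v.base = y ≫ f.app i := by rw [← w, Category.assoc, ht]
  have w₁ : (x ≫ t) ≫ (depProdAt hf g).hom = y ≫ f.app i := by
    rw [Category.assoc, m.hom, w₀]
  have w₂ : x ≫ v.base ≫ A.map (𝟙 i) = y ≫ f.app i := by
    rw [A.map_id, Category.comp_id, w₀]
  have w₃ : ((x ≫ t) ≫ right S g hf) ≫ ((depProd hf).obj _).hom = y ≫ f.app i := by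
    rw [Category.assoc x, w]
  have w₄ : ((x ≫ s) ≫ D.bot) ≫ ((depProd hf).obj _).hom = y ≫ f.app i := by
    rw [Category.assoc x, Category.assoc x, hs, w₀]
  refine (depProdAp_congr hf (Category.assoc x t _).symm rfl w).trans ?_
  refine Eq.trans ?_ (depProdAp_congr hf (Category.assoc x s _) rfl w₄)
  refine pullback.hom_ext (S.matching_hom_ext fun h => ?_) ?_
  · have w₅ : (x ≫ s) ≫ pullback.snd _ _ = y ≫ f.app i := by rw [Category.assoc, ← m.base, w₀]
    have w₆ : x ≫ v.base ≫ A.map h.obj.hom = (y ≫ B.map h.obj.hom) ≫ f.app h.obj.right := by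
      rw [← Category.assoc x, w₀, Category.assoc, Category.assoc]
      exact congrArg (y ≫ ·) (f.naturality h.obj.hom).symm
    have w₇ : x ≫ (v.push h.obj.hom).base ≫ A.map (𝟙 _) =
        (y ≫ B.map h.obj.hom) ≫ f.app h.obj.right := by
      rw [← w₆]; simp
    refine (Category.assoc _ _ _).trans ((depProdAp_right_proj _ y w₃ w₁ h).trans ?_)
    refine Eq.trans ?_ ((D.bot_ap h (x ≫ s) y w₄ (D.base_map_eq w₅ h)).symm.trans
      (Category.assoc _ _ _).symm)
    rw [m.val x y w₁ w₂, ← v.val_map]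
    refine Eq.trans ?_ (Eq.trans (ProdSection.val_eq (m.push h).symm _ x _ w₇) ?_)
    · exact v.val_congr ((Category.id_comp _).trans (Category.comp_id _).symm) rfl rfl _
    · exact (D.u h).val_congr rfl (Category.assoc _ _ _).symm rfl _
  · exact (depProdAp_hom hf _ y w₃).trans (depProdAp_hom hf _ y w₄).symm

/-- An instance of `exists_glue`: `t` supplies the values at `𝟙 i`, `s` supplies the base and the
sections below `i`, and commutativity of the square is the gluing condition. -/
theorem exists_section (s : d ⟶ D.P) (t : d ⟶ (depProdAt hf g).left)
    (hst : t ≫ right S g hf = s ≫ D.bot) : ∃ v : ProdSection f g i d, D.Matches s t v := by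
  have ht : t ≫ (depProdAt hf g).hom = s ≫ pullback.snd _ _ := by
    rw [← D.bot_hom, ← Category.assoc, ← hst, Category.assoc, right_hom]
  have w₁ : ∀ {e : E} {x : e ⟶ d} {y : e ⟶ B.obj i} (_ : x ≫ s ≫ pullback.snd _ _ = y ≫ f.app i),
      (x ≫ t) ≫ (depProdAt hf g).hom = y ≫ f.app i := by
    intro e x y w
    rw [Category.assoc, ht, w]
  obtain ⟨v, hb, hv, hp⟩ := ProdSection.exists_glue (f := f) (g := g) S (s ≫ pullback.snd _ _)
    (fun e x y w => depProdAp hf (x ≫ t) y (w₁ w))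
    (fun e x y w => depProdAp_hom hf _ _ _)
    (fun e e' z x y w => by
      rw [comp_depProdAp]
      exact depProdAp_congr hf (Category.assoc _ _ _) rfl _)
    (fun j h hd => (D.u ⟨Under.mk h, hd⟩).comp (s ≫ pullback.fst _ _ ≫ D.π ⟨Under.mk h, hd⟩))
    (fun j h hd => (D.base_map s ⟨Under.mk h, hd⟩).trans (Category.assoc _ _ _).symm)
    (fun j j' h k hd hd' => by
      let h₁ : S.Below i := ⟨Under.mk h, hd⟩
      let h₂ : S.Below i := ⟨Under.mk (h ≫ k), hd'⟩
      let k' : h₁ ⟶ h₂ := ObjectProperty.homMk (Under.homMk k)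
      rw [← ProdSection.comp_push]
      refine (congrArg _ (D.comp_map k').symm).trans ?_
      rw [ProdSection.comp_comp, Category.assoc, Category.assoc, D.π_map k'])
    -- Evaluate both sides of `hst` at `y` and project to the component `h`.
    (fun j h hd e x y w => by
      let h' : S.Below i := ⟨Under.mk h, hd⟩
      have w₂ : (x ≫ s) ≫ pullback.snd _ _ = y ≫ f.app i := by rw [Category.assoc, w]
      have w₃ : ((x ≫ s) ≫ D.bot) ≫ ((depProd hf).obj _).hom = y ≫ f.app i := by
        rw [Category.assoc (x ≫ s), D.bot_hom, w₂]
      have w₄ : ((x ≫ t) ≫ right S g hf) ≫ ((depProd hf).obj _).hom = y ≫ f.app i := by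
        rw [Category.assoc (x ≫ t), right_hom, w₁ w]
      have e₁ := D.bot_ap h' (x ≫ s) y w₃ (D.base_map_eq w₂ h')
      refine Eq.trans ?_ (e₁.symm.trans (Eq.trans ?_ (depProdAp_right_proj (x ≫ t) y w₄ (w₁ w) h')))
      · exact (D.u h').val_congr rfl (Category.assoc _ _ _).symm rfl _
      · exact congrArg (· ≫ _) (depProdAp_congr hf (by simp only [Category.assoc, hst]) rfl _))
  have w₂ : ∀ {e : E} {x : e ⟶ d} {y : e ⟶ B.obj i} (_ : (x ≫ t) ≫ (depProdAt hf g).hom =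
      y ≫ f.app i), x ≫ s ≫ pullback.snd _ _ = y ≫ f.app i := by
    intro e x y w
    rw [← w, Category.assoc, ht]
  exact ⟨v, hb, ht.trans hb.symm, fun e x y w w' => (hv x y (w₂ w)).symm,
    fun h => (hp h.obj.hom h.property).symm⟩

/-- The pushes of `v` are classified by a compatible family, hence by a map to `L`; the values of
`v` at `𝟙 i` define `t`. -/
theorem exists_matches (v : ProdSection f g i d) :
    ∃ (s : d ⟶ D.P) (t : d ⟶ (depProdAt hf g).left), D.Matches s t v := by
  obtain ⟨z, hz⟩ := D.exists_lift (fun h => (D.univ h).lift (v.push h.obj.hom)) (by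
    intro h h' k
    refine (D.univ h').hom_ext ?_
    rw [← ProdSection.comp_comp, D.comp_map, ProdSection.comp_push, ProdSection.IsUniversal.comp_lift,
      ProdSection.IsUniversal.comp_lift, ProdSection.push_push]
    exact congrArg (fun l => v.push l) (Under.w k.hom))
  have hz' : ∀ h, (D.u h).comp (z ≫ D.π h) = v.push h.obj.hom := fun h => by
    rw [hz, ProdSection.IsUniversal.comp_lift]
  have w : z ≫ D.μ = v.base ≫ (S.matchingMap E i).app A := by
    refine S.matching_hom_ext fun h => ?_
    rw [Category.assoc, Category.assoc, D.μ_proj, S.matchingMap_proj]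
    have := congrArg ProdSection.base (hz' h)
    simpa using this
  have w₁ : ∀ {e : E} {x : e ⟶ d} {y : e ⟶ B.obj i} (_ : x ≫ v.base = y ≫ f.app i),
      x ≫ v.base ≫ A.map (𝟙 i) = y ≫ f.app i := by
    intro e x y w
    rw [A.map_id, Category.comp_id, w]
  obtain ⟨t, ht, ht'⟩ := exists_depProd_lift hf (w := Over.mk (g.app i)) v.base
    (fun e x y w => v.val (𝟙 i) x y (w₁ w)) (fun e x y w => v.val_app _ _ _ _)
    (fun e e' z x y w => v.val_comp _ _ _ _ _)
  refine ⟨pullback.lift z v.base w, t, (pullback.lift_snd _ _ _).symm, ht, fun e x y w w' => ?_,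
    fun h => ?_⟩
  · exact ht' x y (by rw [← w', A.map_id, Category.comp_id])
  · rw [pullback.lift_fst_assoc, hz']

theorem isPullback {r : E} {v : ProdSection f g i r} (hv : v.IsUniversal) {s : r ⟶ D.P}
    {t : r ⟶ (depProdAt hf g).left} (m : D.Matches s t v) :
    IsPullback t s (right S g hf) D.bot := by
  refine ⟨⟨m.w⟩, ⟨PullbackCone.IsLimit.mk _ (fun c => hv.lift
    (exists_section c.snd c.fst c.condition).choose) (fun c => ?_) (fun c => ?_)
    (fun c z h₁ h₂ => ?_)⟩⟩ <;>
    have m₁ := (exists_section c.snd c.fst c.condition).choose_spec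
  · have m₂ := m.comp (hv.lift (exists_section c.snd c.fst c.condition).choose)
    rw [hv.comp_lift] at m₂
    exact m₂.snd_eq m₁
  · have m₂ := m.comp (hv.lift (exists_section c.snd c.fst c.condition).choose)
    rw [hv.comp_lift] at m₂
    exact m₂.fst_eq m₁
  · refine hv.hom_ext ?_
    have m₂ := m.comp z
    rw [h₁, h₂] at m₂
    rw [hv.comp_lift]
    exact m₂.section_eq m₁

/-- The presheaf of sections at `i` is representable. -/
theorem exists_universal (D : MatchingBoundary S g hf) : ∃ (r : E) (v : ProdSection f g i r), v.IsUniversal := by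
  -- The universal section comes from the generic commuting pair, the two projections of the
  -- pullback.
  obtain ⟨v, m⟩ := exists_section (D := D) (pullback.snd (right S g hf) D.bot)
    (pullback.fst (right S g hf) D.bot) pullback.condition
  refine ⟨_, v, fun e => ⟨fun z z' h => ?_, fun v' => ?_⟩⟩
  · have m₁ := m.comp z
    have m₂ := m.comp z'
    simp only at h
    rw [h] at m₁
    exact pullback.hom_ext (m₁.snd_eq m₂) (m₁.fst_eq m₂)
  · obtain ⟨s, t, m'⟩ := exists_matches (D := D) v'
    refine ⟨pullback.lift t s m'.w, ?_⟩
    have m₁ := m.comp (pullback.lift t s m'.w)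
    rw [pullback.lift_fst, pullback.lift_snd] at m₁
    exact m₁.section_eq m'

end MatchingBoundary
end
end

/-! ### Representability of sections, by induction on the degree. -/

noncomputable section

variable {I : Type u₁} [Category.{v₁} I] {S : GeneralisedInverseStructure I}
  {E : Type u₂} [Category.{v₂} E] {A B Z : I ⥤ E} {f : B ⟶ A} {g : Z ⟶ B} {i : I}
  [HasPullbacks E]

namespace BelowCone

variable [HasLimitsOfShape (S.Below i) E] (D : BelowCone S f g i)

/-- The values of the universal sections below `i` form a cone over `I⁻(i) ⥤ I ⥤ E`, hence define an
element of `M_i Z`. -/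
theorem val_map {e : E} (x : e ⟶ D.P) (y : e ⟶ B.obj i)
    (w : x ≫ pullback.snd _ _ = y ≫ f.app i) {h h' : S.Below i} (k : h ⟶ h') :
    (D.u h).val (𝟙 _) (x ≫ pullback.fst _ _ ≫ D.π h) (y ≫ B.map h.obj.hom) (D.base_map_eq w h) ≫
      Z.map k.hom.right =
    (D.u h').val (𝟙 _) (x ≫ pullback.fst _ _ ≫ D.π h') (y ≫ B.map h'.obj.hom)
      (D.base_map_eq w h') := by
  have hx : x ≫ pullback.fst _ _ ≫ D.π h' = (x ≫ pullback.fst _ _ ≫ D.π h) ≫ D.W.map k := by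
    simp only [Category.assoc, D.π_map]
  have hy : y ≫ B.map h'.obj.hom = (y ≫ B.map h.obj.hom) ≫ B.map k.hom.right := by
    rw [Category.assoc]
    refine congrArg (y ≫ ·) (Eq.trans ?_ (B.map_comp _ _))
    exact congrArg B.map (Under.w k.hom).symm
  have w₁ := D.base_map_eq w h'
  have w₂ : (x ≫ pullback.fst _ _ ≫ D.π h) ≫ ((D.u h').comp (D.W.map k)).base ≫ A.map (𝟙 _) =
      ((y ≫ B.map h.obj.hom) ≫ B.map k.hom.right) ≫ f.app h'.obj.right := by
    rw [← hy, ← w₁, hx, ProdSection.comp_base]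
    simp only [Category.assoc]
  rw [← (D.u h).val_map]
  refine Eq.trans ?_ ((ProdSection.val_eq (D.comp_map k) (𝟙 _) _ _ w₂).symm.trans ?_)
  · exact (D.u h).val_congr ((Category.id_comp _).trans (Category.comp_id _).symm) rfl rfl _
  · exact (D.u h').val_congr rfl hx.symm hy.symm _

/-- The bottom map is defined by its values: at `y` it takes the pair of `y` and the element `l x y`
of `M_i Z` assembled from the universal sections below `i`. -/
theorem exists_matchingBoundary (D : BelowCone S f g i) (hf : IsPowerful (f.app i)) :
    Nonempty (MatchingBoundary S g hf) := by
  let c : ∀ {e : E} (x : e ⟶ D.P) (y : e ⟶ B.obj i) (_ : x ≫ pullback.snd _ _ = y ≫ f.app i),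
      Cone (S.belowProj i ⋙ Z) := fun {e} x y w =>
    { pt := e
      π :=
        { app := fun h => (D.u h).val (𝟙 _) (x ≫ pullback.fst _ _ ≫ D.π h)
            (y ≫ B.map h.obj.hom) (D.base_map_eq w h)
          naturality := fun h h' k => (Category.id_comp _).trans (D.val_map x y w k).symm } }
  let l : ∀ {e : E} (x : e ⟶ D.P) (y : e ⟶ B.obj i) (_ : x ≫ pullback.snd _ _ = y ≫ f.app i),
      e ⟶ (S.matching E i).obj Z := fun x y w => limit.lift (S.belowProj i ⋙ Z) (c x y w)
  have hl : ∀ {e : E} (x : e ⟶ D.P) (y : e ⟶ B.obj i) (w : x ≫ pullback.snd _ _ = y ≫ f.app i) h,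
      l x y w ≫ S.matchingProj Z h = (D.u h).val (𝟙 _) (x ≫ pullback.fst _ _ ≫ D.π h)
            (y ≫ B.map h.obj.hom) (D.base_map_eq w h) :=
    fun x y w h => limit.lift_π (c x y w) h
  have hlg : ∀ {e : E} (x : e ⟶ D.P) (y : e ⟶ B.obj i) (w : x ≫ pullback.snd _ _ = y ≫ f.app i),
      l x y w ≫ (S.matching E i).map g = y ≫ (S.matchingMap E i).app B := by
    intro e x y w
    refine S.matching_hom_ext fun h => ?_
    rw [Category.assoc, Category.assoc, S.matching_map_proj, S.matchingMap_proj,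
      ← Category.assoc, hl x y w, ProdSection.val_app]
  have hlz : ∀ {e e' : E} (z : e' ⟶ e) (x : e ⟶ D.P) (y : e ⟶ B.obj i)
      (w : x ≫ pullback.snd _ _ = y ≫ f.app i)
      (w' : (z ≫ x) ≫ pullback.snd _ _ = (z ≫ y) ≫ f.app i),
      l (z ≫ x) (z ≫ y) w' = z ≫ l x y w := by
    intro e e' z x y w w'
    refine S.matching_hom_ext fun h => ?_
    rw [Category.assoc z (l x y w), hl x y w, hl (z ≫ x) (z ≫ y) w', ← ProdSection.val_comp]
    exact (D.u h).val_congr rfl (Category.assoc _ _ _) (Category.assoc _ _ _) _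
  obtain ⟨t, ht, hv⟩ := exists_depProd_lift hf
    (w := (Over.pullback ((S.matchingMap E i).app B)).obj (Over.mk ((S.matching E i).map g)))
    (pullback.snd D.μ ((S.matchingMap E i).app A))
    (fun e x y w => pullback.lift (l x y w) y (hlg x y w))
    (fun e x y w => pullback.lift_snd _ _ _)
    (fun e e' z x y w => pullback.hom_ext
      ((pullback.lift_fst _ _ _).trans ((hlz z x y w
        (by simp only [Category.assoc, w])).trans
        ((congrArg (z ≫ ·) (pullback.lift_fst _ _ _).symm).trans (Category.assoc _ _ _).symm)))
      ((pullback.lift_snd _ _ _).trans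
        ((congrArg (z ≫ ·) (pullback.lift_snd _ _ _).symm).trans (Category.assoc _ _ _).symm)))
  refine ⟨{ D with bot := t, bot_hom := ht, bot_ap := fun h e x y w w' => ?_ }⟩
  have w₁ : x ≫ pullback.snd _ _ = y ≫ f.app i := by rw [← w, Category.assoc, ht]
  refine (congrArg (· ≫ _) (hv x y w₁)).trans ?_
  exact (pullback.lift_fst_assoc _ _ _ _).trans (hl x y w₁ h)

end BelowCone

namespace ProdSection

/-- The cone below `i` determined by representing objects of the presheaves of sections below
`i`. -/
def belowCone [HasLimitsOfShape (S.Below i) E] (r : S.Below i → E)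
    (u : ∀ h : S.Below i, ProdSection f g h.obj.right (r h)) (hu : ∀ h, (u h).IsUniversal) :
    BelowCone S f g i where
  W := sectionFunctor (S.belowProj i) r u hu
  u := u
  univ := hu
  comp_map {h h'} k := (hu h').comp_lift _
  L := limit (sectionFunctor (S.belowProj i) r u hu)
  π h := limit.π (sectionFunctor (S.belowProj i) r u hu) h
  π_map k := limit.w _ k
  exists_lift {e} z hz := ⟨limit.lift (sectionFunctor (S.belowProj i) r u hu)
    { pt := e, π := { app := z, naturality := fun h h' k => (Category.id_comp _).trans (hz k).symm } },
    fun h => limit.lift_π _ h⟩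
  hom_ext w := limit.hom_ext w
  μ := limit.lift (S.belowProj i ⋙ A)
    { pt := limit (sectionFunctor (S.belowProj i) r u hu)
      π :=
        { app := fun h => limit.π (sectionFunctor (S.belowProj i) r u hu) h ≫ (u h).base
          naturality := fun h h' k => by
            have e₁ := limit.w (sectionFunctor (S.belowProj i) r u hu) k
            have e₂ := congrArg ProdSection.base
              ((hu h').comp_lift ((u h).push ((S.belowProj i).map k)))
            refine (Category.id_comp _).trans ((congrArg (· ≫ (u h').base) e₁.symm).trans ?_)
            refine (Category.assoc _ _ _).trans (Eq.trans ?_ (Category.assoc _ _ _).symm)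
            exact congrArg (limit.π (sectionFunctor (S.belowProj i) r u hu) h ≫ ·) e₂ } }
  μ_proj h := limit.lift_π _ h

theorem exists_isUniversal [∀ i : I, HasLimitsOfShape (S.Below i) E] (g : Z ⟶ B)
    (hf : ∀ i : I, IsPowerful (f.app i)) (i : I) :
    ∃ (r : E) (u : ProdSection f g i r), u.IsUniversal := by
  induction hn : S.deg i using Nat.strong_induction_on generalizing i with
  | _ n ih =>
    subst hn
    -- The choices need no coherence: in `sectionFunctor` universality determines the transition
    -- maps, including those along isomorphisms.
    choose r u hu using fun h : S.Below i => ih _ h.property h.obj.right rfl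
    obtain ⟨D⟩ := (belowCone r u hu).exists_matchingBoundary (hf i)
    exact D.exists_universal

end ProdSection
end

/-! ### Values of the canonical comparison maps. -/

noncomputable section

section

variable {D : Type u₁} [Category.{v₁} D] [HasPullbacks D]
  {E : Type u₂} [Category.{v₂} E] [HasPullbacks E]

/-- Giving the element `κ` of `F` of the pullback explicitly keeps `PreservesPullback.iso` out of
later computations. -/
theorem depProdAp_comparison (F : D ⥤ E) [PreservesLimitsOfShape WalkingCospan F] {y x : D}
    {k : y ⟶ x} (hk : IsPowerful k) (hFk : IsPowerful (F.map k)) (z : Over y) {e : E}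
    (κ : e ⟶ F.obj (pullback ((depProd hk).obj z).hom k)) {s : e ⟶ F.obj ((depProd hk).obj z).left}
    {t : e ⟶ F.obj y} (h₁ : κ ≫ F.map (pullback.fst _ _) = s) (h₂ : κ ≫ F.map (pullback.snd _ _) = t)
    (w : (s ≫ (depProdComparison F hk hFk z).left) ≫ ((depProd hFk).obj _).hom = t ≫ F.map k) :
    depProdAp hFk (s ≫ (depProdComparison F hk hFk z).left) t w =
      κ ≫ F.map (depProdEv hk z).left := by
  refine (depProdAp_transpose hFk (d := Over.mk (F.map ((depProd hk).obj z).hom)) _ s t w).trans ?_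
  refine (Category.assoc _ _ _).symm.trans (congrArg (· ≫ F.map (depProdEv hk z).left) ?_)
  refine (Iso.comp_inv_eq _).2 (pullback.hom_ext ?_ ?_)
  · refine (pullback.lift_fst _ _ _).trans (h₁.symm.trans ?_)
    exact (congrArg (κ ≫ ·) (PreservesPullback.iso_hom_fst F _ _).symm).trans
      (Category.assoc _ _ _).symm
  · refine (pullback.lift_snd _ _ _).trans (h₂.symm.trans ?_)
    exact (congrArg (κ ≫ ·) (PreservesPullback.iso_hom_snd F _ _).symm).trans
      (Category.assoc _ _ _).symm

theorem depProdAp_baseChange {b a y x : E} {g : b ⟶ a} {k : y ⟶ x} {β : b ⟶ y} {α : a ⟶ x}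
    (hg : IsPowerful g) (hk : IsPowerful k) (sq : g ≫ α = β ≫ k) (w : Over y) {e : E}
    (s : e ⟶ pullback ((depProd hk).obj w).hom α) (t : e ⟶ b)
    (h : (s ≫ (depProdBaseChange hg hk sq w).left) ≫ ((depProd hg).obj _).hom = t ≫ g)
    (h' : (s ≫ pullback.fst _ _) ≫ ((depProd hk).obj w).hom = (t ≫ β) ≫ k) :
    depProdAp hg (s ≫ (depProdBaseChange hg hk sq w).left) t h ≫ pullback.fst w.hom β =
      depProdAp hk (s ≫ pullback.fst _ _) (t ≫ β) h' := by
  refine (congrArg (· ≫ pullback.fst w.hom β) (depProdAp_transpose hg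
    (d := (Over.pullback α).obj ((depProd hk).obj w)) _ s t h)).trans ?_
  refine (Category.assoc _ _ _).trans ((congrArg (_ ≫ ·) (pullback.lift_fst _ _ _)).trans ?_)
  refine (Category.assoc _ _ _).symm.trans (congrArg (· ≫ (depProdEv hk w).left) ?_)
  refine pullback.hom_ext ?_ ?_
  · refine (Category.assoc _ _ _).trans ((congrArg (_ ≫ ·) (pullback.lift_fst _ _ _)).trans ?_)
    refine (Category.assoc _ _ _).symm.trans (Eq.trans ?_ (pullback.lift_fst _ _ _).symm)
    exact congrArg (· ≫ pullback.fst _ _) (pullback.lift_fst _ _ _)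
  · refine (Category.assoc _ _ _).trans ((congrArg (_ ≫ ·) (pullback.lift_snd _ _ _)).trans ?_)
    refine (Category.assoc _ _ _).symm.trans (Eq.trans ?_ (pullback.lift_snd _ _ _).symm)
    exact congrArg (· ≫ β) (pullback.lift_snd _ _ _)

end

/-! ### Compatible families of universal sections versus evaluation maps in `E^I`. -/

section

variable {I : Type u₁} [Category.{v₁} I] {E : Type u₂} [Category.{v₂} E] [HasPullbacks E]
  {A B Z : I ⥤ E} {f : B ⟶ A} {g : Z ⟶ B}

/-- A generalised element of a pullback in a functor category. -/
def pullbackObjLift {q : Over A} {j : I} {e : E} (x : e ⟶ q.left.obj j) (y : e ⟶ B.obj j)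
    (w : x ≫ q.hom.app j = y ≫ f.app j) : e ⟶ (pullback q.hom f).obj j :=
  ((IsPullback.of_hasPullback q.hom f).map ((evaluation I E).obj j)).lift x y w

section

variable {q : Over A} {j : I} {e : E} (x : e ⟶ q.left.obj j) (y : e ⟶ B.obj j)
  (w : x ≫ q.hom.app j = y ≫ f.app j)

@[simp]
theorem pullbackObjLift_fst : pullbackObjLift x y w ≫ (pullback.fst q.hom f).app j = x :=
  IsPullback.lift_fst _ _ _ _

@[simp]
theorem pullbackObjLift_snd : pullbackObjLift x y w ≫ (pullback.snd q.hom f).app j = y :=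
  IsPullback.lift_snd _ _ _ _

@[simp]
theorem pullbackObjLift_fst_assoc {e' : E} (z : q.left.obj j ⟶ e') :
    pullbackObjLift x y w ≫ (pullback.fst q.hom f).app j ≫ z = x ≫ z := by
  rw [← Category.assoc, pullbackObjLift_fst]

@[simp]
theorem pullbackObjLift_snd_assoc {e' : E} (z : B.obj j ⟶ e') :
    pullbackObjLift x y w ≫ (pullback.snd q.hom f).app j ≫ z = y ≫ z := by
  rw [← Category.assoc, pullbackObjLift_snd]

theorem pullback_obj_hom_ext {z z' : e ⟶ (pullback q.hom f).obj j}
    (h₁ : z ≫ (pullback.fst q.hom f).app j = z' ≫ (pullback.fst q.hom f).app j)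
    (h₂ : z ≫ (pullback.snd q.hom f).app j = z' ≫ (pullback.snd q.hom f).app j) : z = z' :=
  ((IsPullback.of_hasPullback q.hom f).map ((evaluation I E).obj j)).hom_ext h₁ h₂

end

namespace ProdSection

variable {q : Over A} (ε : (Over.pullback f).obj q ⟶ Over.mk g)

/-- The section determined by an evaluation map. -/
@[simps]
def ofEval (i : I) : ProdSection f g i (q.left.obj i) where
  base := q.hom.app i
  val j h e x y w := pullbackObjLift (x ≫ q.left.map h) y
    (by rw [← w, Category.assoc, q.hom.naturality]) ≫ ε.left.app j
  val_app j h e x y w := by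
    have h₁ : ε.left.app j ≫ g.app j = (pullback.snd q.hom f).app j :=
      congrArg (fun t => NatTrans.app t j) (Over.w ε)
    rw [Category.assoc, h₁, pullbackObjLift_snd]
  val_comp j h e e' z x y w := by
    refine Eq.trans ?_ (Category.assoc _ _ _)
    refine congrArg (· ≫ ε.left.app j) (pullback_obj_hom_ext ?_ ?_) <;> simp
  val_map j j' h k e x y w := by
    refine Eq.trans ?_ (Category.assoc _ _ _).symm
    refine Eq.trans ?_ (congrArg (_ ≫ ·) (ε.left.naturality k))
    refine Eq.trans ?_ (Category.assoc _ _ _)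
    refine congrArg (· ≫ ε.left.app j') (pullback_obj_hom_ext ?_ ?_)
    · refine (pullbackObjLift_fst _ _ _).trans (Eq.trans ?_ (Category.assoc _ _ _).symm)
      refine Eq.trans ?_ (congrArg (_ ≫ ·) ((pullback.fst q.hom f).naturality k).symm)
      rw [pullbackObjLift_fst_assoc, Category.assoc, q.left.map_comp]
    · refine (pullbackObjLift_snd _ _ _).trans (Eq.trans ?_ (Category.assoc _ _ _).symm)
      refine Eq.trans ?_ (congrArg (_ ≫ ·) ((pullback.snd q.hom f).naturality k).symm)
      rw [pullbackObjLift_snd_assoc]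

theorem ofEval_comp_map {i j : I} (h : i ⟶ j) :
    (ofEval ε j).comp (q.left.map h) = (ofEval ε i).push h :=
  ext (q.hom.naturality h) fun j' k e x y w =>
    congrArg (· ≫ ε.left.app j') (pullback_obj_hom_ext (by simp) (by simp))

theorem ofEval_map {q' : Over A} (t : q' ⟶ q) (i : I) :
    ofEval ((Over.pullback f).map t ≫ ε) i = (ofEval ε i).comp (t.left.app i) := by
  refine ext (congrArg (fun s => NatTrans.app s i) (Over.w t)).symm fun j h e x y w => ?_
  refine (Category.assoc _ _ _).symm.trans (congrArg (· ≫ ε.left.app j) ?_)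
  refine pullback_obj_hom_ext ?_ ?_
  · refine (Category.assoc _ _ _).trans (Eq.trans ?_ (pullbackObjLift_fst _ _ _).symm)
    refine (congrArg (_ ≫ ·) (congrArg (fun s => NatTrans.app s j)
      (pullback.lift_fst (f := q.hom) (g := f) (pullback.fst _ _ ≫ t.left) _ _))).trans ?_
    refine (pullbackObjLift_fst_assoc _ _ _ _).trans ?_
    simp
  · refine (Category.assoc _ _ _).trans (Eq.trans ?_ (pullbackObjLift_snd _ _ _).symm)
    refine (congrArg (_ ≫ ·) (congrArg (fun s => NatTrans.app s j)
      (pullback.lift_snd (f := q.hom) (g := f) (pullback.fst _ _ ≫ t.left) _ _))).trans ?_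
    exact pullbackObjLift_snd _ _ _

/-- The component of `ε` at `i` is recovered as the value of its section at `𝟙 i` on the two
pullback projections. -/
theorem eval_ext {ε ε' : (Over.pullback f).obj q ⟶ Over.mk g}
    (h : ∀ i, ofEval ε i = ofEval ε' i) : ε = ε' := by
  refine Over.OverMorphism.ext (NatTrans.ext (funext fun i => ?_))
  have w : (pullback.fst q.hom f).app i ≫ q.hom.app i ≫ A.map (𝟙 i) =
      (pullback.snd q.hom f).app i ≫ f.app i := by
    rw [A.map_id, Category.comp_id]
    exact congrArg (fun s => NatTrans.app s i) (pullback.condition (f := q.hom) (g := f))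
  have e := val_eq (h i) (𝟙 i) ((pullback.fst q.hom f).app i) ((pullback.snd q.hom f).app i) w
  have e₁ : pullbackObjLift (f := f) ((pullback.fst q.hom f).app i ≫ q.left.map (𝟙 i))
      ((pullback.snd q.hom f).app i) (by
        rw [← w, Category.assoc, q.hom.naturality]) = 𝟙 _ :=
    pullback_obj_hom_ext (by simp) (by simp)
  exact (Category.id_comp _).symm.trans ((congrArg (· ≫ ε.left.app i) e₁).symm.trans
    (e.trans ((congrArg (· ≫ ε'.left.app i) e₁).trans (Category.id_comp _))))

/-- Inverse to `ofEval`: the component at `i` is the value of `u i` at `𝟙 i` on the two projections.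
It is natural in `i` by `val_map` and the compatibility `hu`. -/
theorem exists_eval {X : I ⥤ E} (u : ∀ i, ProdSection f g i (X.obj i))
    (hu : ∀ {i j : I} (h : i ⟶ j), (u j).comp (X.map h) = (u i).push h) :
    ∃ (p : X ⟶ A) (ε : (Over.pullback f).obj (Over.mk p) ⟶ Over.mk g),
      ∀ i, ofEval ε i = u i := by
  let p : X ⟶ A :=
    { app := fun i => (u i).base
      naturality := fun i j h => congrArg base (hu h) }
  have w : ∀ i, (pullback.fst p f).app i ≫ (u i).base ≫ A.map (𝟙 i) =
      (pullback.snd p f).app i ≫ f.app i := fun i => by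
    rw [A.map_id, Category.comp_id]
    exact congrArg (fun s => NatTrans.app s i) (pullback.condition (f := p) (g := f))
  let φ : pullback p f ⟶ Z :=
    { app := fun i => (u i).val (𝟙 i) ((pullback.fst p f).app i) ((pullback.snd p f).app i) (w i)
      naturality := fun i j h => by
        have w₁ : ((pullback.fst p f).app i ≫ X.map h) ≫ (u j).base ≫ A.map (𝟙 j) =
            ((pullback.snd p f).app i ≫ B.map h) ≫ f.app j := by
          rw [← (pullback.fst p f).naturality, ← (pullback.snd p f).naturality, Category.assoc,
            Category.assoc, w]
        rw [← (u j).val_comp, ← (u i).val_map]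
        refine ((u j).val_congr rfl ((pullback.fst p f).naturality h)
          ((pullback.snd p f).naturality h) _).trans ((val_comp_eq (hu h) _ _ w₁ ?_).trans ?_)
        · have := w₁
          have hb := congrArg base (hu h)
          simp only [comp_base, push_base] at hb
          rw [Category.assoc, A.map_id, Category.comp_id, hb] at this
          exact this
        · exact (u i).val_congr (Category.id_comp h).symm rfl rfl _ }
  refine ⟨p, Over.homMk φ (NatTrans.ext (funext fun i => (u i).val_app _ _ _ _)), fun i => ?_⟩
  refine ext rfl fun j h e x y w' => ?_
  have w₁ : (x ≫ X.map h) ≫ p.app j = y ≫ f.app j := by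
    rw [← w', Category.assoc, p.naturality]; rfl
  have w₂ : (x ≫ X.map h) ≫ p.app j ≫ A.map (𝟙 j) = y ≫ f.app j := by
    rw [A.map_id, Category.comp_id, w₁]
  refine ((u j).val_comp (𝟙 j) (pullbackObjLift (q := Over.mk p) (x ≫ X.map h) y w₁)
    _ _ (w j)).symm.trans ?_
  refine ((u j).val_congr rfl (pullbackObjLift_fst _ _ _) (pullbackObjLift_snd _ _ _) _).trans ?_
  exact val_comp_eq (hu h) x y w₂ w'

end ProdSection

end
end

/-! ### The right adjoint, and the matching square of the resulting dependent product. -/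

noncomputable section

section

variable {I : Type u₁} [Category.{v₁} I] {E : Type u₂} [Category.{v₂} E] [HasPullbacks E]
  {A B Z : I ⥤ E} {f : B ⟶ A} {g : Z ⟶ B}

namespace ProdSection

/-- An evaluation map all of whose sections are universal exhibits a dependent product. -/
def isTerminalOfUniversal {q : Over A} {ε : (Over.pullback f).obj q ⟶ Over.mk g}
    (hε : ∀ i, (ofEval ε i).IsUniversal) :
    IsTerminal (CostructuredArrow.mk ε : CostructuredArrow (Over.pullback f) (Over.mk g)) :=
  IsTerminal.ofUniqueHom
    (fun Y => CostructuredArrow.homMk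
      (Over.homMk
        { app := fun i => (hε i).lift (ofEval Y.hom i)
          -- Componentwise classifying maps are natural because both composites classify the same
          -- section.
          naturality := fun i j h => (hε j).hom_ext (by
            rw [← comp_comp, ← comp_comp, (hε j).comp_lift]
            refine (ofEval_comp_map Y.hom h).trans (Eq.trans ?_ (congrArg _
              (ofEval_comp_map ε h).symm))
            rw [comp_push, (hε i).comp_lift]) }
        (NatTrans.ext (funext fun i => congrArg base ((hε i).comp_lift (ofEval Y.hom i)))))
      (eval_ext fun i => (ofEval_map ε _ i).trans ((hε i).comp_lift _)))
    (fun Y m => by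
      refine CostructuredArrow.hom_ext _ _ (Over.OverMorphism.ext (NatTrans.ext (funext fun i =>
        (hε i).hom_ext ?_)))
      refine (ofEval_map ε m.left i).symm.trans (Eq.trans ?_ ((hε i).comp_lift _).symm)
      exact congrArg (fun t => ofEval t i) (CostructuredArrow.w m))

theorem exists_isUniversal_ofEval (h : ∀ i : I, ∃ (r : E) (u : ProdSection f g i r), u.IsUniversal) :
    ∃ (q : Over A) (ε : (Over.pullback f).obj q ⟶ Over.mk g), ∀ i, (ofEval ε i).IsUniversal := by
  choose r u hu using h
  obtain ⟨p, ε, hε⟩ := exists_eval (X := sectionFunctor (𝟭 I) r u hu) u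
    (fun h => (hu _).comp_lift _)
  exact ⟨Over.mk p, ε, fun i => by rw [hε]; exact hu i⟩

/-- A functor is a left adjoint as soon as each of its comma categories over an object has a
terminal object. -/
theorem isPowerful (h : ∀ {Z : I ⥤ E} (g : Z ⟶ B) (i : I),
    ∃ (r : E) (u : ProdSection f g i r), u.IsUniversal) : IsPowerful f := by
  refine ⟨inferInstance, isLeftAdjoint_iff_hasTerminal_costructuredArrow.2 fun C => ?_⟩
  obtain ⟨q, ε, hε⟩ := exists_isUniversal_ofEval (h C.hom)
  exact (isTerminalOfUniversal hε).hasTerminal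

/-- The sections determined by the evaluation map of a dependent product are universal as soon
as the presheaves of sections are representable. -/
theorem isUniversal_ofEval_depProdEv (hf : IsPowerful f)
    (h : ∀ i : I, ∃ (r : E) (u : ProdSection f g i r), u.IsUniversal) (i : I) :
    (ofEval (depProdEv hf (Over.mk g)) i).IsUniversal := by
  obtain ⟨q, ε, hε⟩ := exists_isUniversal_ofEval h
  -- The counit and the constructed evaluation are both terminal in the same comma category, so they
  -- differ by an isomorphism over `A`.
  let T := mkTerminalOfRightAdjoint _ (depProdAdj hf) (Over.mk g)
  let e := T.uniqueUpToIso (isTerminalOfUniversal hε)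
  have w : (Over.pullback f).map e.hom.left ≫ ε = depProdEv hf (Over.mk g) :=
    CostructuredArrow.w e.hom
  have : IsIso e.hom.left :=
    inferInstanceAs (IsIso ((CostructuredArrow.proj (Over.pullback f) (Over.mk g)).map e.hom))
  have : IsIso e.hom.left.left := inferInstanceAs (IsIso ((Over.forget A).map e.hom.left))
  rw [← w, ofEval_map]
  exact (hε i).of_isIso (e.hom.left.left.app i)

end ProdSection

variable (S : GeneralisedInverseStructure I) [∀ i : I, HasLimitsOfShape (S.Below i) E]

open ProdSection

/-- The cone below `i` given by a dependent product. -/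
def depProdBelowCone (hpow : IsPowerful f) {g : Z ⟶ B}
    (hu : ∀ i, (ofEval (depProdEv hpow (Over.mk g)) i).IsUniversal) (i : I) :
    BelowCone S f g i where
  W := S.belowProj i ⋙ ((depProd hpow).obj (Over.mk g)).left
  u h := ofEval (depProdEv hpow (Over.mk g)) h.obj.right
  univ h := hu h.obj.right
  comp_map k := ofEval_comp_map _ k.hom.right
  L := (S.matching E i).obj ((depProd hpow).obj (Over.mk g)).left
  π h := S.matchingProj _ h
  π_map k := S.matchingProj_map _ k
  exists_lift {e} z hz := ⟨limit.lift (S.belowProj i ⋙ ((depProd hpow).obj (Over.mk g)).left)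
    { pt := e, π := { app := z, naturality := fun _ _ k => (Category.id_comp _).trans (hz k).symm } },
    fun h => limit.lift_π _ h⟩
  hom_ext w := S.matching_hom_ext w
  μ := (S.matching E i).map ((depProd hpow).obj (Over.mk g)).hom
  μ_proj h := S.matching_map_proj _ h

/-- Verifies `bot_ap` for the bottom map of the theorem. Evaluating the two transposes in turn gives
`M_i(ev)` at an element of `M_i (B ×_A Π_B Z)`, and projecting to `h` gives the component of `ev`
there. -/
theorem depProdAp_matching_bottom {i : I} (hf : IsPowerful (f.app i))
    (hMf : IsPowerful ((S.matching E i).map f)) (hpow : IsPowerful f) (g : Z ⟶ B) (h : S.Below i)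
    {e : E} (x : e ⟶ pullback ((S.matching E i).map ((depProd hpow).obj (Over.mk g)).hom)
      ((S.matchingMap E i).app A)) (y : e ⟶ B.obj i)
    (w : (x ≫ ((Over.pullback ((S.matchingMap E i).app A)).map
        (depProdComparison (S.matching E i) hpow hMf (Over.mk g)) ≫
      depProdBaseChange hf hMf ((S.matchingMap E i).naturality f)
        (Over.mk ((S.matching E i).map g))).left) ≫ ((depProd hf).obj _).hom = y ≫ f.app i)
    (w' : (x ≫ pullback.fst _ _ ≫ S.matchingProj _ h) ≫
      ((depProd hpow).obj (Over.mk g)).hom.app h.obj.right ≫ A.map (𝟙 h.obj.right) =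
        (y ≫ B.map h.obj.hom) ≫ f.app h.obj.right) :
    depProdAp hf (x ≫ ((Over.pullback ((S.matchingMap E i).app A)).map
        (depProdComparison (S.matching E i) hpow hMf (Over.mk g)) ≫
      depProdBaseChange hf hMf ((S.matchingMap E i).naturality f)
        (Over.mk ((S.matching E i).map g))).left) y w ≫
      pullback.fst ((S.matching E i).map g) ((S.matchingMap E i).app B) ≫ S.matchingProj Z h =
    (ofEval (depProdEv hpow (Over.mk g)) h.obj.right).val (𝟙 _)
      (x ≫ pullback.fst _ _ ≫ S.matchingProj _ h) (y ≫ B.map h.obj.hom) w' := by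
  let q := (depProd hpow).obj (Over.mk g)
  let c := depProdComparison (S.matching E i) hpow hMf (Over.mk g)
  let b := depProdBaseChange hf hMf ((S.matchingMap E i).naturality f)
    (Over.mk ((S.matching E i).map g))
  let x₀ : e ⟶ (S.matching E i).obj q.left := x ≫ pullback.fst _ _
  let s : e ⟶ pullback ((depProd hMf).obj (Over.mk ((S.matching E i).map g))).hom
      ((S.matchingMap E i).app A) := x ≫ ((Over.pullback ((S.matchingMap E i).app A)).map c).left
  have hs : s ≫ pullback.fst _ _ = x₀ ≫ c.left :=
    (Category.assoc _ _ _).trans ((congrArg (x ≫ ·) (pullback.lift_fst _ _ _)).trans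
      (Category.assoc _ _ _).symm)
  have hsb : x ≫ ((Over.pullback ((S.matchingMap E i).app A)).map c ≫ b).left = s ≫ b.left :=
    (Category.assoc _ _ _).symm
  have w₀ : x ≫ pullback.snd _ _ = y ≫ f.app i := by
    refine Eq.trans ?_ w
    exact (congrArg (x ≫ ·) (Over.w ((Over.pullback ((S.matchingMap E i).app A)).map c ≫ b)).symm).trans
      (Category.assoc _ _ _).symm
  have w₁ : x₀ ≫ (S.matching E i).map q.hom =
      (y ≫ (S.matchingMap E i).app B) ≫ (S.matching E i).map f := by
    have n : f.app i ≫ (S.matchingMap E i).app A =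
      (S.matchingMap E i).app B ≫ (S.matching E i).map f := (S.matchingMap E i).naturality f
    rw [Category.assoc, Category.assoc, pullback.condition, ← n, ← Category.assoc, w₀,
      Category.assoc]
  have w₂ : (x₀ ≫ c.left) ≫ ((depProd hMf).obj (Over.mk ((S.matching E i).map g))).hom =
      (y ≫ (S.matchingMap E i).app B) ≫ (S.matching E i).map f :=
    (Category.assoc _ _ _).trans ((congrArg (x₀ ≫ ·) (Over.w c)).trans w₁)
  -- `S.matching E i` preserves the pullback defining the domain of `ev`, so `x₀` and the image of
  -- `y` in `M_i B` determine an element of its matching object.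
  let κ := ((IsPullback.of_hasPullback q.hom f).map (S.matching E i)).lift x₀
    (y ≫ (S.matchingMap E i).app B) w₁
  have hκ₁ : κ ≫ (S.matching E i).map (pullback.fst q.hom f) = x₀ := IsPullback.lift_fst _ _ _ _
  have hκ₂ : κ ≫ (S.matching E i).map (pullback.snd q.hom f) = y ≫ (S.matchingMap E i).app B :=
    IsPullback.lift_snd _ _ _ _
  have e₁ : depProdAp hf (s ≫ b.left) y (by rw [← hsb]; exact w) ≫
      pullback.fst ((S.matching E i).map g) ((S.matchingMap E i).app B) =
      κ ≫ (S.matching E i).map (depProdEv hpow (Over.mk g)).left :=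
    (depProdAp_baseChange hf hMf ((S.matchingMap E i).naturality f)
      (Over.mk ((S.matching E i).map g)) s y _ (by rw [hs]; exact w₂)).trans
    ((depProdAp_congr hMf hs rfl _).trans
      (depProdAp_comparison (S.matching E i) hpow hMf (Over.mk g) κ hκ₁ hκ₂ w₂))
  refine (Category.assoc _ _ _).symm.trans ?_
  refine (congrArg (fun t => (t ≫ pullback.fst ((S.matching E i).map g)
    ((S.matchingMap E i).app B)) ≫ S.matchingProj Z h) (depProdAp_congr hf hsb rfl w)).trans ?_
  refine (congrArg (· ≫ S.matchingProj Z h) e₁).trans ((Category.assoc _ _ _).trans ?_)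
  refine (congrArg (κ ≫ ·) (S.matching_map_proj (depProdEv hpow (Over.mk g)).left h)).trans ?_
  refine (Category.assoc _ _ _).symm.trans
    (congrArg (· ≫ (depProdEv hpow (Over.mk g)).left.app h.obj.right) ?_)
  refine pullback_obj_hom_ext ?_ ?_
  · refine Eq.trans ?_ (pullbackObjLift_fst _ _ _).symm
    refine (Category.assoc _ _ _).trans
      ((congrArg (κ ≫ ·) (S.matching_map_proj (pullback.fst q.hom f) h).symm).trans ?_)
    rw [← Category.assoc, hκ₁, CategoryTheory.Functor.map_id, Category.comp_id, Category.assoc]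
  · refine Eq.trans ?_ (pullbackObjLift_snd _ _ _).symm
    refine (Category.assoc _ _ _).trans
      ((congrArg (κ ≫ ·) (S.matching_map_proj (pullback.snd q.hom f) h).symm).trans ?_)
    rw [← Category.assoc, hκ₂, Category.assoc, S.matchingMap_proj]

/-- The bottom map of the matching square of a dependent product. -/
def depProdMatchingBoundary (hf : ∀ i : I, IsPowerful (f.app i))
    (hMf : ∀ i : I, IsPowerful ((S.matching E i).map f)) (hpow : IsPowerful f) {g : Z ⟶ B}
    (hu : ∀ i, (ofEval (depProdEv hpow (Over.mk g)) i).IsUniversal) (i : I) :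
    MatchingBoundary S g (hf i) where
  toBelowCone := depProdBelowCone S hpow hu i
  bot := ((Over.pullback ((S.matchingMap E i).app A)).map
      (depProdComparison (S.matching E i) hpow (hMf i) (Over.mk g)) ≫
    depProdBaseChange (hf i) (hMf i) ((S.matchingMap E i).naturality f)
      (Over.mk ((S.matching E i).map g))).left
  bot_hom := Over.w ((Over.pullback ((S.matchingMap E i).app A)).map
      (depProdComparison (S.matching E i) hpow (hMf i) (Over.mk g)) ≫
    depProdBaseChange (hf i) (hMf i) ((S.matchingMap E i).naturality f)
      (Over.mk ((S.matching E i).map g)))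
  bot_ap h {_} x y w w' := depProdAp_matching_bottom S (hf i) (hMf i) hpow g h x y w w'

/-- Identifies the left and top maps of the theorem as the pair corresponding to the universal
section at `i`, which is what `MatchingBoundary.isPullback` requires. -/
theorem depProdMatchingBoundary_matches (hf : ∀ i : I, IsPowerful (f.app i))
    (hMf : ∀ i : I, IsPowerful ((S.matching E i).map f)) (hpow : IsPowerful f) {g : Z ⟶ B}
    (hu : ∀ i, (ofEval (depProdEv hpow (Over.mk g)) i).IsUniversal) (i : I) :
    (depProdMatchingBoundary S hf hMf hpow hu i).Matches
      (S.relMatchingMap ((depProd hpow).obj (Over.mk g)) i).left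
      (depProdComparison ((evaluation I E).obj i) hpow (hf i) (Over.mk g)).left
      (ofEval (depProdEv hpow (Over.mk g)) i) where
  base := (pullback.lift_snd _ _ _).symm
  hom := Over.w (depProdComparison ((evaluation I E).obj i) hpow (hf i) (Over.mk g))
  val e x y w w' := by
    have w₁ : (x ≫ ((depProd hpow).obj (Over.mk g)).left.map (𝟙 i)) ≫
        ((depProd hpow).obj (Over.mk g)).hom.app i = y ≫ f.app i := by
      refine Eq.trans ?_ w'
      exact (Category.assoc _ _ _).trans (congrArg (x ≫ ·)
        (((depProd hpow).obj (Over.mk g)).hom.naturality (𝟙 i)))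
    refine depProdAp_comparison ((evaluation I E).obj i) hpow (hf i) (Over.mk g)
      (pullbackObjLift (x ≫ ((depProd hpow).obj (Over.mk g)).left.map (𝟙 i)) y w₁)
      ((pullbackObjLift_fst _ _ _).trans ?_) (pullbackObjLift_snd _ _ _) w
    rw [CategoryTheory.Functor.map_id]
    exact Category.comp_id _
  push h := by
    refine Eq.trans ?_ (ofEval_comp_map (depProdEv hpow (Over.mk g)) h.obj.hom)
    refine congrArg (fun t => (ofEval (depProdEv hpow (Over.mk g)) h.obj.right).comp t) ?_
    refine (Category.assoc _ _ _).symm.trans ?_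
    refine (congrArg (· ≫ S.matchingProj _ h) (pullback.lift_fst _ _ _)).trans ?_
    exact S.matchingMap_proj _ h

end

theorem mainTheorem7 {I : Type u₁} [Category.{v₁} I] (S : GeneralisedInverseStructure I)
    {E : Type u₂} [Category.{v₂} E] [HasPullbacks E] [∀ i : I, HasLimitsOfShape (S.Below i) E]
    {A B : I ⥤ E} (f : B ⟶ A)
    (hf : ∀ i : I, IsPowerful (f.app i))
    (hMf : ∀ i : I, IsPowerful ((S.matching E i).map f))
    (hconn : ∀ n : ℕ, CategoryTheory.IsPreconnected (S.Stratum n) ∨ HasInitial E) :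
    ∃ hpow : IsPowerful f, ∀ (C : Over B) (i : I),
      IsPullback
        -- top: `(Π_B C) i ⟶ Π_{B i} (C i)`
        (depProdComparison ((evaluation I E).obj i) hpow (hf i) C).left
        -- left: `(Π_B C) i ⟶ A i ×_{M_i A} M_i (Π_B C)`
        (S.relMatchingMap ((depProd hpow).obj C) i).left
        -- right: `Π_{B i} (C i) ⟶ Π_{B i} (B i ×_{M_i B} M_i C)`
        ((depProd (hf i)).map (S.relMatchingMap C i)).left
        -- bottom: `A i ×_{M_i A} M_i (Π_B C) ⟶ A i ×_{M_i A} Π_{M_i B} (M_i C)`, followed by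
        -- `A i ×_{M_i A} Π_{M_i B} (M_i C) ⟶ Π_{B i} (B i ×_{M_i B} M_i C)`
        ((Over.pullback ((S.matchingMap E i).app A)).map
              (depProdComparison (S.matching E i) hpow (hMf i) C) ≫
            depProdBaseChange (hf i) (hMf i) ((S.matchingMap E i).naturality f)
              (Over.mk ((S.matching E i).map C.hom))).left := by
  have hu : ∀ {Z : I ⥤ E} (g : Z ⟶ B) (i : I), ∃ (r : E) (u : ProdSection f g i r),
    u.IsUniversal := fun g i => ProdSection.exists_isUniversal (S := S) g hf i
  refine ⟨ProdSection.isPowerful hu, fun C i => ?_⟩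
  obtain ⟨Z, g, rfl⟩ := Over.mk_surjective C
  have hu' := ProdSection.isUniversal_ofEval_depProdEv (ProdSection.isPowerful hu) (hu g)
  exact MatchingBoundary.isPullback (hu' i)
    (depProdMatchingBoundary_matches S hf hMf (ProdSection.isPowerful hu) hu' i)
end
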